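/- \textbf{Multiplicities of roots in $\mathbb{S}_{\max}$.} Let $(\Gamma,+,0,\le)$ be a non-trivial, divisible, totally ordered abelian group, and let $\mathbb{T}_{\max}=\Gamma\cup\{\bot\}$ be the tropical semifield, with addition $\max$, multiplication $+$, zero $\bot$ and unit $0$. The symmetrized tropical semiring $\mathbb{S}_{\max}=\mathbb{S}_{\max}(\Gamma)$ is the quotient of the semiring of pairs $\mathbb{T}_{\max}^2$, with operations $(a_1,a_2)\oplus(b_1,b_2)=(a_1\oplus b_1,a_2\oplus b_2)$ and $(a_1,a_2)\odot(b_1,b_2)=(a_1b_1\oplus a_2b_2,\,a_1b_2\oplus a_2b_1)$, by the congruence which identifies $(a_1,a_2)$ and $(b_1,b_2)$ iff either they are equal, or $a_1\ne a_2$, $b_1\neq b_2$ and $a_1\oplus b_2=a_2\oplus b_1$. Write $\mathbb{0},\mathbb{1}$ for its zero and unit, $\ominus(a_1,a_2)=(a_2,a_1)$, $|(a_1,a_2)|=a_1\oplus a_2\in\mathbb{T}_{\max}$; $\mathbb{T}_{\max}$ is embedded in $\mathbb{S}_{\max}$ by $c\mapsto(c,\bot)$. Balanced elements are the classes of the $(c,c)$;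 the set $\mathbb{S}_{\max}^\vee$ of signed elements consists of the classes of the $(c,\bot)$ and $(\bot,c)$ with $c\in\mathbb{T}_{\max}$. Write $a\,\nabla\, b$ if $a\ominus b$ is balanced; for polynomials the relation is taken coefficientwise. Let $\mathbb{B}_{\mathrm s}=\mathbb{S}_{\max}(\{0\})$, embedded in $\mathbb{S}_{\max}(\Gamma)$, so that $\mathbb{B}_{\mathrm s}^\vee=\{\mathbb{0},\mathbb{1},\ominus\mathbb{1}\}$. For a non-zero $P\in\mathbb{S}_{\max}^\vee[\mathsf Y]$ (a formal polynomial with coefficients in $\mathbb{S}_{\max}^\vee$) and $a\in\mathbb{S}_{\max}^\vee$, the multiplicity $\mathrm{mult}_a(P)$ is defined recursively: it is $0$ if $\widehat P(a)$ is not balanced (where $\widehat P$ is the polynomial function of $P$), and otherwise $$\mathrm{mult}_a(P)=1+\max\{\mathrm{mult}_a(Q)\mid Q\in\mathbb{S}_{\max}^\vee[\mathsf Y],\ \lambda\in\mathbb{S}_{\max}^\vee\setminus\{\mathbb{0}\},\ \lambda P\,\nabla\,(\mathsf Y\ominus a)Q\}.$$ Multiplicities over $\mathbb{B}_{\mathrm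 s}^\vee$ are defined in the same way, with $\Gamma$ replaced by $\{0\}$. Let $P=\bigoplus_{i=0}^nP_i\mathsf Y^i\in\mathbb{S}_{\max}^\vee[\mathsf Y]$ be a non-zero formal polynomial of degree $n\ge0$ and let $r\in\mathbb{S}_{\max}^\vee$. If $r=\mathbb{0}$, then $\mathrm{mult}_r(P)$ is the lower degree $\min\{i\mid P_i\ne\mathbb{0}\}$ of $P$. If $r\ne\mathbb{0}$, then: \begin{enumerate} \item $r$ is invertible. \item $|\widehat P(r)|=\widehat{|P|}(|r|)$, where $|P|=\bigoplus_i|P_i|\mathsf Y^i$; this element of $\mathbb{T}_{\max}\setminus\{\bot\}$ is invertible and depends (for fixed $P$) only on $|r|$. Set $\overline P^{\,r}:=\bigoplus_{i=0}^n\overline P^{\,r}_i\mathsf Y^i$ with $\overline P^{\,r}_i:=|\widehat P(r)|^{\odot-1}\odot r^{\odot i}\odot P_i$; then $\overline P^{\,r}\in\mathbb{S}_{\max}^\vee[\mathsf Y]$. \item The saturation set $\mathrm{sat}(r,P):=\{i\in\{0,\dots,n\}\mid|\widehat P(r)|=|P_i|\odot|r|^{\odot i}\}$ depends (for fixed $P$)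 only on $|r|$, and equals $\mathrm{sat}(\mathbb{1},\overline P^{\,r})$. \item The saturation polynomial $P^{\mathrm{sat},r}:=\bigoplus_{i\in\mathrm{sat}(r,P)}\overline P^{\,r}_i\mathsf Y^i$ has its coefficients in $\{\mathbb{0},\mathbb{1},\ominus\mathbb{1}\}=\mathbb{B}_{\mathrm s}^\vee$, and $\mathrm{mult}_{\mathbb{1}}(P^{\mathrm{sat},r})$ is the same whether $P^{\mathrm{sat},r}$ is considered over $\mathbb{B}_{\mathrm s}^\vee$ or over $\mathbb{S}_{\max}^\vee$. \item $\mathrm{mult}_r(P)=\mathrm{mult}_{\mathbb{1}}(\overline P^{\,r})=\mathrm{mult}_{\mathbb{1}}(P^{\mathrm{sat},r})$, and this number is the number of sign changes in the coefficients $p_i$ of $P^{\mathrm{sat},r}$, that is, the number of indices $i$ for which there is $k\ge1$ with $p_i=\ominus p_{i+k}\ne\mathbb{0}$ and $p_{i+1}=\dots=p_{i+k-1}=\mathbb{0}$. \end{enumerate} -/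

import Mathlib

/-! Formal polynomials over the symmetrized tropical semiring and multiplicities of their roots. -/

set_option linter.unusedSectionVars false

/-- The tropical semifield over a totally ordered abelian group `Γ`: the set `Γ ∪ {⊥}` with the
addition `max` and the multiplication `+`.  Its zero is `⊥` and its unit is `0 : Γ`. -/
def Tmax (Γ : Type*) : Type _ := WithBot Γ

namespace Tmax

variable {Γ : Type*} [AddCommGroup Γ] [LinearOrder Γ]

instance : LinearOrder (Tmax Γ) := inferInstanceAs (LinearOrder (WithBot Γ))

/-- The element of the tropical semifield given by an element of `Γ`. -/
def ofGroup (c : Γ) : Tmax Γ := (c : WithBot Γ)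

instance : Zero (Tmax Γ) := ⟨(⊥ : WithBot Γ)⟩

instance : One (Tmax Γ) := ⟨ofGroup 0⟩

instance : Add (Tmax Γ) := ⟨fun a b => max a b⟩

instance : Mul (Tmax Γ) := ⟨fun a b => (show WithBot Γ from a) + (show WithBot Γ from b)⟩

/-- Tropical inverse: `c ↦ -c` on `Γ`, and `⊥ ↦ ⊥` by convention. -/
instance : Inv (Tmax Γ) := ⟨fun a => WithBot.map (fun c : Γ => -c) a⟩

theorem add_def (a b : Tmax Γ) : a + b = max a b := rfl

theorem mul_def (a b : Tmax Γ) : a * b = (show WithBot Γ from a) + (show WithBot Γ from b) := rfl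

theorem zero_le' (a : Tmax Γ) : 0 ≤ a := bot_le (α := WithBot Γ) (a := a)

variable [IsOrderedAddMonoid Γ]

instance : Semifield (Tmax Γ) where
  add_assoc a b c := max_assoc a b c
  zero_add a := max_eq_right (zero_le' a)
  add_zero a := max_eq_left (zero_le' a)
  add_comm a b := max_comm a b
  nsmul := nsmulRec
  left_distrib a b c := add_max (α := WithBot Γ) a b c
  right_distrib a b c := max_add (α := WithBot Γ) a b c
  zero_mul a := WithBot.bot_add (α := Γ) a
  mul_zero a := WithBot.add_bot (α := Γ) a
  mul_assoc a b c := add_assoc (G := WithBot Γ) a b c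
  one_mul a := zero_add (M := WithBot Γ) a
  mul_one a := add_zero (M := WithBot Γ) a
  mul_comm a b := add_comm (G := WithBot Γ) a b
  exists_pair_ne := ⟨(⊥ : WithBot Γ), ((0 : Γ) : WithBot Γ), WithBot.bot_ne_coe⟩
  inv_zero := rfl
  mul_inv_cancel a ha := by
    induction a using WithBot.recBotCoe with
    | bot => exact absurd rfl ha
    | coe c =>
      change ((c : WithBot Γ) + ((-c : Γ) : WithBot Γ)) = ((0 : Γ) : WithBot Γ)
      rw [← WithBot.coe_add, add_neg_cancel]
  nnqsmul := _
  nnqsmul_def := fun _ _ => rfl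

theorem mul_lt_mul_right' {a b c : Tmax Γ} (h : a < b) (hc : c ≠ 0) : a * c < b * c :=
  WithBot.add_lt_add_right (α := Γ) hc h

theorem mul_le_mul_right' {a b : Tmax Γ} (h : a ≤ b) (c : Tmax Γ) : a * c ≤ b * c :=
  add_le_add (α := WithBot Γ) h le_rfl

theorem mul_le_mul_left' {a b : Tmax Γ} (h : a ≤ b) (c : Tmax Γ) : c * a ≤ c * b := by
  rw [mul_comm c, mul_comm c]; exact mul_le_mul_right' h c

theorem mul_lt_mul_left' {a b c : Tmax Γ} (h : a < b) (hc : c ≠ 0) : c * a < c * b := by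
  rw [mul_comm c, mul_comm c]; exact mul_lt_mul_right' h hc

variable (Γ) in
/-- The inclusion of the Boolean semifield, i.e. the tropical semifield over the trivial group,
in any tropical semifield. -/
def ofBool : Tmax PUnit.{1} →+* Tmax Γ where
  toFun a := WithBot.map (fun _ => (0 : Γ)) a
  map_zero' := rfl
  map_one' := rfl
  map_add' a b := by
    induction a using WithBot.recBotCoe <;> induction b using WithBot.recBotCoe
    · exact (max_self (α := WithBot Γ) ⊥).symm
    · exact (max_eq_right (α := WithBot Γ) bot_le).symm
    · exact (max_eq_left (α := WithBot Γ) bot_le).symm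
    · exact (max_self (α := WithBot Γ) _).symm
  map_mul' a b := by
    induction a using WithBot.recBotCoe <;> induction b using WithBot.recBotCoe
    · rfl
    · rfl
    · rfl
    · exact congrArg (WithBot.some) (add_zero (0 : Γ)).symm

theorem ofBool_injective : Function.Injective (ofBool Γ) :=
  WithBot.map_injective (fun _ _ _ => rfl)

end Tmax

/-- Pairs `(a₁, a₂)` of elements of the tropical semifield, to be read as `a₁ ⊖ a₂`. -/
@[ext] structure SymPair (Γ : Type*) where
  pos : Tmax Γ
  neg : Tmax Γ

namespace SymPair

variable {Γ : Type*} [AddCommGroup Γ] [LinearOrder Γ] [IsOrderedAddMonoid Γ]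

instance : Zero (SymPair Γ) := ⟨⟨0, 0⟩⟩

instance : One (SymPair Γ) := ⟨⟨1, 0⟩⟩

instance : Add (SymPair Γ) := ⟨fun a b => ⟨a.pos + b.pos, a.neg + b.neg⟩⟩

instance : Mul (SymPair Γ) :=
  ⟨fun a b => ⟨a.pos * b.pos + a.neg * b.neg, a.pos * b.neg + a.neg * b.pos⟩⟩

/-- The minus operator `⊖ (a₁, a₂) = (a₂, a₁)`. -/
instance : Neg (SymPair Γ) := ⟨fun a => ⟨a.neg, a.pos⟩⟩

@[simp] theorem zero_pos : (0 : SymPair Γ).pos = 0 := rfl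
@[simp] theorem zero_neg : (0 : SymPair Γ).neg = 0 := rfl
@[simp] theorem one_pos : (1 : SymPair Γ).pos = 1 := rfl
@[simp] theorem one_neg : (1 : SymPair Γ).neg = 0 := rfl
@[simp] theorem add_pos (a b : SymPair Γ) : (a + b).pos = a.pos + b.pos := rfl
@[simp] theorem add_neg (a b : SymPair Γ) : (a + b).neg = a.neg + b.neg := rfl
@[simp] theorem mul_pos (a b : SymPair Γ) :
    (a * b).pos = a.pos * b.pos + a.neg * b.neg := rfl
@[simp] theorem mul_neg (a b : SymPair Γ) :
    (a * b).neg = a.pos * b.neg + a.neg * b.pos := rfl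
@[simp] theorem neg_pos (a : SymPair Γ) : (-a).pos = a.neg := rfl
@[simp] theorem neg_neg (a : SymPair Γ) : (-a).neg = a.pos := rfl

instance : CommSemiring (SymPair Γ) where
  add_assoc a b c := by ext <;> simp [add_assoc]
  zero_add a := by ext <;> simp
  add_zero a := by ext <;> simp
  add_comm a b := by ext <;> simp [add_comm]
  nsmul := nsmulRec
  left_distrib a b c := by ext <;> simp <;> ring
  right_distrib a b c := by ext <;> simp <;> ring
  zero_mul a := by ext <;> simp
  mul_zero a := by ext <;> simp
  mul_assoc a b c := by ext <;> simp <;> ring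
  one_mul a := by ext <;> simp
  mul_one a := by ext <;> simp
  mul_comm a b := by ext <;> simp <;> ring

/-- The equivalence relation on pairs which refines the balance relation. -/
def Rel (a b : SymPair Γ) : Prop :=
  if a.pos ≠ a.neg ∧ b.pos ≠ b.neg then a.pos + b.neg = a.neg + b.pos else a = b

theorem rel_iff (a b : SymPair Γ) : Rel a b ↔
    a = b ∨ (a.neg < a.pos ∧ b.neg < b.pos ∧ a.pos = b.pos) ∨
      (a.pos < a.neg ∧ b.pos < b.neg ∧ a.neg = b.neg) := by
  obtain ⟨x, y⟩ := a
  obtain ⟨z, w⟩ := b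
  simp only [Rel, Tmax.add_def, SymPair.mk.injEq]
  grind

theorem rel_refl (a : SymPair Γ) : Rel a a := (rel_iff a a).2 (Or.inl rfl)

theorem rel_symm {a b : SymPair Γ} (h : Rel a b) : Rel b a := by
  rw [rel_iff] at *
  grind

theorem rel_trans {a b c : SymPair Γ} (h : Rel a b) (h' : Rel b c) : Rel a c := by
  rw [rel_iff] at *
  grind

theorem rel_neg {a b : SymPair Γ} (h : Rel a b) : Rel (-a) (-b) := by
  rw [rel_iff] at *
  rcases h with rfl | h | h
  · exact Or.inl rfl
  · exact Or.inr (Or.inr h)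
  · exact Or.inr (Or.inl h)

theorem rel_add_right {a b : SymPair Γ} (h : Rel a b) (c : SymPair Γ) :
    Rel (a + c) (b + c) := by
  obtain ⟨x, y⟩ := a
  obtain ⟨z, w⟩ := b
  obtain ⟨u, v⟩ := c
  rw [rel_iff] at *
  simp only [Tmax.add_def, SymPair.ext_iff, add_pos, add_neg] at *
  grind

/-- A pair with a dominating first entry `x`, times a pair with a dominating first entry `u`. -/
theorem mul_dom {x y u v : Tmax Γ} (h : y < x) (k : v < u) :
    x * v + y * u < x * u + y * v ∧ x * u + y * v = x * u := by
  have hx : x ≠ 0 := (lt_of_le_of_lt (Tmax.zero_le' y) h).ne'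
  have hu : u ≠ 0 := (lt_of_le_of_lt (Tmax.zero_le' v) k).ne'
  have h1 : x * v < x * u := Tmax.mul_lt_mul_left' k hx
  have h2 : y * u < x * u := Tmax.mul_lt_mul_right' h hu
  have h3 : y * v ≤ x * v := Tmax.mul_le_mul_right' h.le v
  simp only [Tmax.add_def]
  grind

theorem rel_mul_dom {x y w u v : Tmax Γ} (h : y < x) (h' : w < x) :
    Rel ((⟨x, y⟩ : SymPair Γ) * ⟨u, v⟩) (⟨x, w⟩ * ⟨u, v⟩) := by
  rw [rel_iff]
  simp only [SymPair.ext_iff, mul_pos, mul_neg]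
  rcases lt_trichotomy u v with k | k | k
  · have e1 := mul_dom h k
    have e2 := mul_dom h' k
    right; right
    exact ⟨e1.1, e2.1, e1.2.trans e2.2.symm⟩
  · subst k
    left
    have e1 : y * u ≤ x * u := Tmax.mul_le_mul_right' h.le u
    have e2 : w * u ≤ x * u := Tmax.mul_le_mul_right' h'.le u
    simp only [Tmax.add_def, max_eq_left e1, max_eq_left e2, and_self]
  · have e1 := mul_dom h k
    have e2 := mul_dom h' k
    right; left
    exact ⟨e1.1, e2.1, e1.2.trans e2.2.symm⟩

theorem neg_mul' (a b : SymPair Γ) : (-a) * b = -(a * b) := by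
  ext <;> simp [add_comm]

theorem rel_mul_right {a b : SymPair Γ} (h : Rel a b) (c : SymPair Γ) :
    Rel (a * c) (b * c) := by
  obtain ⟨x, y⟩ := a
  obtain ⟨z, w⟩ := b
  obtain ⟨u, v⟩ := c
  rcases (rel_iff _ _).1 h with h | ⟨h1, h2, h3⟩ | ⟨h1, h2, h3⟩
  · rw [h]; exact rel_refl _
  · simp only at h1 h2 h3
    subst h3
    exact rel_mul_dom h1 h2
  · simp only at h1 h2 h3
    subst h3
    have := rel_neg (rel_mul_dom (u := u) (v := v) h1 h2)
    rwa [← neg_mul', ← neg_mul'] at this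

variable (Γ) in
/-- The relation `Rel` as a congruence of the semiring of pairs. -/
def con : RingCon (SymPair Γ) where
  r := Rel
  iseqv := ⟨rel_refl, rel_symm, rel_trans⟩
  add' {a b c d} h h' := by
    have h1 := rel_add_right h c
    have h2 := rel_add_right h' b
    rw [add_comm c, add_comm d] at h2
    exact rel_trans h1 h2
  mul' {a b c d} h h' := by
    have h1 := rel_mul_right h c
    have h2 := rel_mul_right h' b
    rw [mul_comm c, mul_comm d] at h2
    exact rel_trans h1 h2

end SymPair

/-- The symmetrized tropical semiring over `Γ`. -/
def Smax (Γ : Type*) [AddCommGroup Γ] [LinearOrder Γ] [IsOrderedAddMonoid Γ] : Type _ :=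
  (SymPair.con Γ).Quotient

/-- The symmetrized Boolean semiring. -/
abbrev Bs : Type := Smax PUnit.{1}

namespace Smax

open Polynomial

variable {Γ : Type*} [AddCommGroup Γ] [LinearOrder Γ] [IsOrderedAddMonoid Γ]

instance : CommSemiring (Smax Γ) := inferInstanceAs (CommSemiring (SymPair.con Γ).Quotient)

variable (Γ) in
/-- The quotient map. -/
def mkHom : SymPair Γ →+* Smax Γ := (SymPair.con Γ).mk'

/-- The class of the pair `(a₁, a₂)`. -/
def mk (a₁ a₂ : Tmax Γ) : Smax Γ := mkHom Γ ⟨a₁, a₂⟩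

theorem mkHom_eq_iff {a b : SymPair Γ} : mkHom Γ a = mkHom Γ b ↔ SymPair.Rel a b :=
  (SymPair.con Γ).eq

theorem mk_eq_iff {a₁ a₂ b₁ b₂ : Tmax Γ} :
    mk a₁ a₂ = mk b₁ b₂ ↔ SymPair.Rel ⟨a₁, a₂⟩ ⟨b₁, b₂⟩ :=
  mkHom_eq_iff

theorem mk_surjective (a : Smax Γ) : ∃ a₁ a₂ : Tmax Γ, a = mk a₁ a₂ := by
  obtain ⟨⟨x, y⟩, h⟩ := RingCon.mk'_surjective (c := SymPair.con Γ) a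
  exact ⟨x, y, h.symm⟩

/-- The minus operator `⊖` (not an additive inverse). -/
instance : Neg (Smax Γ) :=
  ⟨Quotient.map (fun a : SymPair Γ => -a) (fun _ _ h => SymPair.rel_neg h)⟩

theorem neg_mk (a₁ a₂ : Tmax Γ) : -(mk a₁ a₂) = mk a₂ a₁ := rfl

theorem mk_add_mk (a₁ a₂ b₁ b₂ : Tmax Γ) :
    mk a₁ a₂ + mk b₁ b₂ = mk (a₁ + b₁) (a₂ + b₂) := rfl

theorem mk_mul_mk (a₁ a₂ b₁ b₂ : Tmax Γ) :
    mk a₁ a₂ * mk b₁ b₂ = mk (a₁ * b₁ + a₂ * b₂) (a₁ * b₂ + a₂ * b₁) := rfl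

/-- The identification of the tropical semifield with the positive or zero elements. -/
def ofT : Tmax Γ →+* Smax Γ where
  toFun c := mk c 0
  map_zero' := rfl
  map_one' := rfl
  map_add' a b := by rw [mk_add_mk, add_zero]
  map_mul' a b := by rw [mk_mul_mk]; simp

/-- The absolute value `|(a₁, a₂)| = a₁ ⊕ a₂`, a morphism of semirings. -/
def absHom : Smax Γ →+* Tmax Γ :=
  (SymPair.con Γ).lift
    { toFun := fun a => a.pos + a.neg
      map_zero' := by simp
      map_one' := by simp
      map_add' := fun a b => by simp only [SymPair.add_pos, SymPair.add_neg]; ring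
      map_mul' := fun a b => by simp only [SymPair.mul_pos, SymPair.mul_neg]; ring }
    (by
      intro a b h
      change a.pos + a.neg = b.pos + b.neg
      rcases (SymPair.rel_iff a b).1 h with rfl | h | h
      · rfl
      all_goals
        simp only [Tmax.add_def]
        grind)

theorem absHom_mk (a₁ a₂ : Tmax Γ) : absHom (mk a₁ a₂) = a₁ + a₂ := rfl

variable (Γ) in
/-- The inclusion of the symmetrized Boolean semiring, `(a₁, a₂) ↦ (a₁, a₂)`. -/
def ofBs : Bs →+* Smax Γ :=
  (SymPair.con PUnit.{1}).lift
    ((mkHom Γ).comp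
      { toFun := fun a => ⟨Tmax.ofBool Γ a.pos, Tmax.ofBool Γ a.neg⟩
        map_zero' := by ext <;> simp
        map_one' := by ext <;> simp
        map_add' := fun a b => by ext <;> simp
        map_mul' := fun a b => by ext <;> simp })
    (by
      intro a b h
      refine mkHom_eq_iff.2 ?_
      have h' : SymPair.Rel a b := h
      unfold SymPair.Rel at h' ⊢
      simp only [ne_eq, RingHom.coe_mk, MonoidHom.coe_mk, OneHom.coe_mk,
        Tmax.ofBool_injective.eq_iff]
      split_ifs at h' ⊢ with hc
      · rw [← map_add, ← map_add, h']
      · rw [h'])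

theorem ofBs_mk (a₁ a₂ : Tmax PUnit.{1}) :
    ofBs Γ (mk a₁ a₂) = mk (Tmax.ofBool Γ a₁) (Tmax.ofBool Γ a₂) := rfl

/-- Signed elements: the positive, negative or zero ones. -/
def IsSigned (a : Smax Γ) : Prop := ∃ c : Tmax Γ, a = mk c 0 ∨ a = mk 0 c

/-- Balanced elements. -/
def IsBalanced (a : Smax Γ) : Prop := ∃ c : Tmax Γ, a = mk c c

/-- Tangible elements: the non-zero signed elements. -/
def IsTangible (a : Smax Γ) : Prop := IsSigned a ∧ a ≠ 0

/-- The surpassing relation `a ⪯° b`. -/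
def Surpass (a b : Smax Γ) : Prop := ∃ c, IsBalanced c ∧ b = a + c

/-- The balance relation `a ∇ b`, meaning `0 ⪯° a ⊖ b`. -/
def Balances (a b : Smax Γ) : Prop := Surpass 0 (a + -b)

/-- On representatives, `(a₁, a₂) ∇ (b₁, b₂)` means `a₁ ⊕ b₂ = a₂ ⊕ b₁`. -/
theorem balances_mk (a₁ a₂ b₁ b₂ : Tmax Γ) :
    Balances (mk a₁ a₂) (mk b₁ b₂) ↔ a₁ + b₂ = a₂ + b₁ := by
  simp only [Balances, Surpass, IsBalanced, neg_mk, mk_add_mk, zero_add]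
  constructor
  · rintro ⟨_, ⟨c, rfl⟩, h⟩
    rw [mk_eq_iff, SymPair.rel_iff] at h
    simp only [SymPair.mk.injEq] at h
    grind
  · intro h
    exact ⟨_, ⟨a₁ + b₂, rfl⟩, by rw [h]⟩

/-- Formal polynomials with signed coefficients. -/
def SignedPoly (P : (Smax Γ)[X]) : Prop := ∀ i, IsSigned (P.coeff i)

/-- The coefficient-wise balance relation. -/
def PolyBalances (P Q : (Smax Γ)[X]) : Prop := ∀ i, Balances (P.coeff i) (Q.coeff i)

/-- `a` is a root of `P`. -/
def IsRootOf (a : Smax Γ) (P : (Smax Γ)[X]) : Prop := Surpass 0 (P.eval a)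

/-- The signed polynomials `Q` such that `λ P ∇ (Y ⊖ a) Q` for some tangible `λ`. -/
def quotients (a : Smax Γ) (P : (Smax Γ)[X]) : Set (Smax Γ)[X] :=
  {Q | SignedPoly Q ∧ ∃ l : Smax Γ, IsTangible l ∧ PolyBalances (C l * P) ((X + C (-a)) * Q)}

open Classical in
/-- One step of the recursion that defines multiplicities. -/
noncomputable def multStep (a : Smax Γ) : ((Smax Γ)[X] → ℕ∞) →o ((Smax Γ)[X] → ℕ∞) where
  toFun f P := if IsRootOf a P then 1 + ⨆ Q ∈ quotients a P, f Q else 0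
  monotone' f g h P := by
    dsimp only
    split_ifs
    · gcongr with Q hQ
      exact h Q
    · exact le_rfl

/-- The multiplicity of `a` as a root of `P`, defined recursively by `mult a P = 0` if `a` is not a
root of `P` and `mult a P = 1 + max {mult a Q | Q ∈ quotients a P}` otherwise (see `mult_eq`).
On non-zero signed polynomials the recursion decreases the degree, so that it has only one
solution. -/
noncomputable def mult (a : Smax Γ) : (Smax Γ)[X] → ℕ∞ := OrderHom.lfp (multStep a)

open Classical in
theorem mult_eq (a : Smax Γ) (P : (Smax Γ)[X]) :
    mult a P = if IsRootOf a P then 1 + ⨆ Q ∈ quotients a P, mult a Q else 0 :=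
  (congrFun (OrderHom.map_lfp (multStep a)) P).symm

/-- The normalized polynomial `|P(r)|⁻¹ P(r Y)`. -/
noncomputable def normalized (P : (Smax Γ)[X]) (r : Smax Γ) : (Smax Γ)[X] :=
  ∑ i ∈ Finset.range (P.natDegree + 1),
    monomial i (ofT (absHom (P.eval r))⁻¹ * r ^ i * P.coeff i)

/-- The saturation set. -/
noncomputable def sat (r : Smax Γ) (P : (Smax Γ)[X]) : Finset ℕ :=
  (Finset.range (P.natDegree + 1)).filter fun i =>
    absHom (P.eval r) = absHom (P.coeff i) * absHom r ^ i

/-- The saturation polynomial. -/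
noncomputable def satPoly (P : (Smax Γ)[X]) (r : Smax Γ) : (Smax Γ)[X] :=
  ∑ i ∈ sat r P, monomial i ((normalized P r).coeff i)

/-- The number of sign changes in the sequence of non-zero coefficients: the number of `i` such
that `P_i = ⊖ P_{i+k} ≠ 0` and `P_{i+1} = ⋯ = P_{i+k-1} = 0` for some `k ≥ 1`. -/
noncomputable def signChanges (P : (Smax Γ)[X]) : ℕ∞ :=
  Set.encard {i : ℕ | i < P.natDegree ∧ ∃ k : ℕ, 1 ≤ k ∧
    P.coeff i = -(P.coeff (i + k)) ∧ P.coeff (i + k) ≠ 0 ∧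
    ∀ j, i < j → j < i + k → P.coeff j = 0}

end Smax

/-! ### Maxima of finite families in the tropical semifield -/

namespace Tmax

variable {Γ : Type*} [AddCommGroup Γ] [LinearOrder Γ] [IsOrderedAddMonoid Γ]

/-! The proof is a tropical form of Descartes' rule of signs. Substituting `r Y` for `Y` moves a
non-zero root `r` to `1`. At the root `1` only the coefficients of maximal absolute value matter,
and only through their signs: `signs P` records these, with `0` for all other coefficients. The
formula to prove is that the multiplicity equals the number of sign changes of this sequence
(`mult_eq_encard_changes`).

Upper bound. If `λ P ∇ (Y ⊖ 1) Q`, then both sides have the same maximal absolute value, and keeping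
only the coefficients at that level turns the balance relations into relations between sign
sequences. A combinatorial count (`SignSeq.count_succ_le`) shows that the sequence of `P` has at
least one more change than that of `Q`.

Lower bound. If `signs P` has a change, `exists_polyBalances` builds a quotient `Q` that loses only
one: below the first change `Q` follows the dominant coefficient already passed, with the opposite
sign; from there on it follows the dominant coefficient still to come. Since `P` has the root `1`
exactly when a change exists (`isRootOf_one_iff`), induction on the number of changes gives the
formula.

Normalization rescales all coefficients by a common positive factor, and saturation deletes
coefficients that are invisible in `signs`, so neither changes the count. The formula holds for
every `Γ`, the trivial group included, which gives the comparison with `Bs`. The root zero is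
separate: there a quotient must be `P / Y` up to a scalar. -/

theorem le_sum {ι : Type*} (s : Finset ι) (f : ι → Tmax Γ) {i : ι} (hi : i ∈ s) :
    f i ≤ ∑ j ∈ s, f j := by
  classical
  rw [← Finset.add_sum_erase s f hi, add_def]
  exact le_max_left _ _

theorem exists_eq_sum {ι : Type*} (s : Finset ι) (f : ι → Tmax Γ) (h : ∑ j ∈ s, f j ≠ 0) :
    ∃ i ∈ s, f i = ∑ j ∈ s, f j := by
  classical
  induction s using Finset.induction_on with
  | empty => simp at h
  | insert a s ha ih =>
    rw [Finset.sum_insert ha, add_def] at h ⊢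
    rcases le_total (f a) (∑ j ∈ s, f j) with h' | h'
    · rw [max_eq_right h'] at h ⊢
      obtain ⟨i, hi, e⟩ := ih h
      exact ⟨i, Finset.mem_insert_of_mem hi, e⟩
    · rw [max_eq_left h']
      exact ⟨a, Finset.mem_insert_self _ _, rfl⟩

end Tmax

/-! ### Canonical representatives, signed elements and the balance relation -/

namespace Smax

open Polynomial

variable {Γ : Type*} [AddCommGroup Γ] [LinearOrder Γ] [IsOrderedAddMonoid Γ]

/-- The first entry of the canonical representative of an element. -/
def plus : Smax Γ → Tmax Γ :=
  Quotient.lift (fun a : SymPair Γ => if a.neg ≤ a.pos then a.pos else 0) (by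
    intro a b h
    rcases (SymPair.rel_iff a b).1 h with rfl | h | h <;> grind)

/-- The second entry of the canonical representative of an element. -/
def minus (a : Smax Γ) : Tmax Γ := plus (-a)

theorem plus_mk (x y : Tmax Γ) : plus (mk x y) = if y ≤ x then x else 0 := rfl

theorem minus_mk (x y : Tmax Γ) : minus (mk x y) = if x ≤ y then y else 0 := rfl

/-- Each class has one representative of the form `(x, ⊥)`, `(⊥, x)` or `(x, x)`. Passing to it
turns statements about signs and balance into statements about maxima in a linear order. -/
theorem mk_plus_minus (a : Smax Γ) : mk (plus a) (minus a) = a := by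
  obtain ⟨x, y, rfl⟩ := mk_surjective a
  have hx := Tmax.zero_le' x
  have hy := Tmax.zero_le' y
  rw [plus_mk, minus_mk, mk_eq_iff, SymPair.rel_iff]
  simp only [SymPair.mk.injEq]
  grind

theorem plus_neg (a : Smax Γ) : plus (-a) = minus a := rfl

theorem minus_neg (a : Smax Γ) : minus (-a) = plus a := by
  obtain ⟨x, y, rfl⟩ := mk_surjective a
  rfl

protected theorem neg_neg (a : Smax Γ) : -(-a) = a := by
  obtain ⟨x, y, rfl⟩ := mk_surjective a
  rfl

protected theorem neg_zero : -(0 : Smax Γ) = 0 := rfl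

protected theorem neg_mul (a b : Smax Γ) : (-a) * b = -(a * b) := by
  obtain ⟨x, y, rfl⟩ := mk_surjective a
  obtain ⟨z, w, rfl⟩ := mk_surjective b
  simp only [neg_mk, mk_mul_mk]
  congr 1 <;> ring

protected theorem mul_neg (a b : Smax Γ) : a * (-b) = -(a * b) := by
  rw [mul_comm, Smax.neg_mul, mul_comm]

theorem absHom_eq_max (a : Smax Γ) : absHom a = max (plus a) (minus a) := by
  conv_lhs => rw [← mk_plus_minus a]
  rfl

theorem absHom_neg (a : Smax Γ) : absHom (-a) = absHom a := by
  rw [absHom_eq_max, absHom_eq_max, plus_neg, minus_neg, max_comm]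

theorem ext_plus_minus {a b : Smax Γ} (h : plus a = plus b) (h' : minus a = minus b) : a = b := by
  rw [← mk_plus_minus a, ← mk_plus_minus b, h, h']

theorem plus_zero : plus (0 : Smax Γ) = 0 := by
  change plus (mk 0 0) = 0
  rw [plus_mk, if_pos le_rfl]

theorem minus_zero : minus (0 : Smax Γ) = 0 := plus_zero

theorem isSigned_iff (a : Smax Γ) : IsSigned a ↔ plus a = 0 ∨ minus a = 0 := by
  constructor
  · rintro ⟨c, rfl | rfl⟩
    · have := Tmax.zero_le' c
      rw [plus_mk, minus_mk]
      grind
    · have := Tmax.zero_le' c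
      rw [plus_mk, minus_mk]
      grind
  · intro h
    rw [← mk_plus_minus a]
    rcases h with h | h <;> rw [h]
    exacts [⟨_, Or.inr rfl⟩, ⟨_, Or.inl rfl⟩]

theorem isSigned_zero : IsSigned (0 : Smax Γ) := ⟨0, Or.inl rfl⟩

theorem isSigned_one : IsSigned (1 : Smax Γ) := ⟨1, Or.inl rfl⟩

theorem IsSigned.neg {a : Smax Γ} (h : IsSigned a) : IsSigned (-a) := by
  obtain ⟨c, rfl | rfl⟩ := h
  exacts [⟨c, Or.inr rfl⟩, ⟨c, Or.inl rfl⟩]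

theorem isSigned_ofT (c : Tmax Γ) : IsSigned (ofT c) := ⟨c, Or.inl rfl⟩

theorem IsSigned.exists_ofT {a : Smax Γ} (h : IsSigned a) :
    ∃ c : Tmax Γ, a = ofT c ∨ a = -ofT c := h

theorem IsSigned.mul {a b : Smax Γ} (ha : IsSigned a) (hb : IsSigned b) : IsSigned (a * b) := by
  obtain ⟨c, rfl | rfl⟩ := ha.exists_ofT <;> obtain ⟨d, rfl | rfl⟩ := hb.exists_ofT <;>
    simp only [Smax.neg_mul, Smax.mul_neg, Smax.neg_neg, ← map_mul]
  exacts [isSigned_ofT _, (isSigned_ofT _).neg, (isSigned_ofT _).neg, isSigned_ofT _]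

theorem IsSigned.pow {a : Smax Γ} (ha : IsSigned a) (n : ℕ) : IsSigned (a ^ n) := by
  induction n with
  | zero => rw [pow_zero]; exact isSigned_one
  | succ n ih => rw [pow_succ]; exact ih.mul ha

theorem absHom_ofT (c : Tmax Γ) : absHom (ofT c) = c := by
  change absHom (mk c 0) = c
  rw [absHom_mk, add_zero]

theorem absHom_eq_zero_iff {a : Smax Γ} : absHom a = 0 ↔ a = 0 := by
  constructor
  · intro h
    have h1 := Tmax.zero_le' (plus a)
    have h2 := Tmax.zero_le' (minus a)
    rw [absHom_eq_max] at h
    apply ext_plus_minus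
    · rw [plus_zero]; grind
    · rw [minus_zero]; grind
  · rintro rfl
    exact map_zero _

theorem IsSigned.isUnit {a : Smax Γ} (ha : IsSigned a) (h0 : a ≠ 0) : IsUnit a := by
  obtain ⟨c, hc⟩ := ha.exists_ofT
  have hc0 : c ≠ 0 := by
    rintro rfl
    rcases hc with rfl | rfl
    · exact h0 (map_zero _)
    · exact h0 (by rw [map_zero]; rfl)
  have h1 : ofT c * ofT c⁻¹ = 1 := by rw [← map_mul, mul_inv_cancel₀ hc0, map_one]
  rcases hc with rfl | rfl
  · exact IsUnit.of_mul_eq_one _ h1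
  · exact IsUnit.of_mul_eq_one (-ofT c⁻¹) (by
      rw [Smax.neg_mul, Smax.mul_neg, Smax.neg_neg, h1])

theorem IsSigned.exists_inv {a : Smax Γ} (ha : IsSigned a) (h0 : a ≠ 0) :
    ∃ b : Smax Γ, IsSigned b ∧ b ≠ 0 ∧ a * b = 1 := by
  obtain ⟨c, hc⟩ := ha.exists_ofT
  obtain ⟨b, hb⟩ := (ha.isUnit h0).exists_right_inv
  have key : absHom a * absHom b = 1 := by rw [← map_mul, hb, map_one]
  have hb0 : absHom b ≠ 0 := right_ne_zero_of_mul_eq_one key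
  -- The square of a signed element is positive, so its inverse is a positive multiple of the
  -- element itself, and therefore signed.
  have e : b = a * ofT ((absHom b) ^ 2) := by
    have ha2 : a * a = ofT (absHom a ^ 2) := by
      rcases hc with rfl | rfl
      · rw [absHom_ofT, map_pow, sq]
      · rw [Smax.neg_mul, Smax.mul_neg, Smax.neg_neg, absHom_neg, absHom_ofT, map_pow, sq]
    calc b = b * ofT ((absHom a * absHom b) ^ 2) := by rw [key, one_pow, map_one, mul_one]
      _ = a * b * a * ofT ((absHom b) ^ 2) := by
        rw [mul_pow, map_mul, ← ha2]; ring
      _ = a * ofT ((absHom b) ^ 2) := by rw [hb, one_mul]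
  refine ⟨b, ?_, fun h => hb0 (absHom_eq_zero_iff.2 h), hb⟩
  rw [e]
  exact ha.mul (isSigned_ofT _)

theorem mul_ne_zero' {a b : Smax Γ} (ha : a ≠ 0) (hb : b ≠ 0) : a * b ≠ 0 := by
  intro h
  have : absHom a * absHom b = 0 := by rw [← map_mul, h, map_zero]
  rcases mul_eq_zero.1 this with h | h
  exacts [ha (absHom_eq_zero_iff.1 h), hb (absHom_eq_zero_iff.1 h)]

theorem one_ne_zero' : (1 : Smax Γ) ≠ 0 := by
  intro h
  have : (1 : Tmax Γ) = 0 := by rw [← map_one absHom, h, map_zero]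
  exact one_ne_zero this

theorem pow_ne_zero' {a : Smax Γ} (ha : a ≠ 0) (n : ℕ) : a ^ n ≠ 0 := by
  induction n with
  | zero => rw [pow_zero]; exact one_ne_zero'
  | succ n ih => rw [pow_succ]; exact mul_ne_zero' ih ha

theorem balances_iff (a b : Smax Γ) :
    Balances a b ↔ max (plus a) (minus b) = max (minus a) (plus b) := by
  conv_lhs => rw [← mk_plus_minus a, ← mk_plus_minus b, balances_mk]
  rfl

theorem balances_add_iff (a b c : Smax Γ) :
    Balances a (b + c) ↔ max (plus a) (max (minus b) (minus c)) =
      max (minus a) (max (plus b) (plus c)) := by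
  conv_lhs => rw [← mk_plus_minus a, ← mk_plus_minus b, ← mk_plus_minus c, mk_add_mk, balances_mk]
  rfl

theorem surpass_zero_mk (x y : Tmax Γ) : Surpass 0 (mk x y) ↔ x = y := by
  simp only [Surpass, IsBalanced, zero_add]
  constructor
  · rintro ⟨_, ⟨c, rfl⟩, h⟩
    rw [mk_eq_iff, SymPair.rel_iff] at h
    simp only [SymPair.mk.injEq] at h
    grind
  · rintro rfl
    exact ⟨_, ⟨_, rfl⟩, rfl⟩

/-- Each side has an entry `⊥`. With equal signs the equation of maxima identifies the remaining
entries; with opposite signs it forces both to be `⊥`. -/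
theorem Balances.eq {a b : Smax Γ} (h : Balances a b) (ha : IsSigned a) (hb : IsSigned b) :
    a = b := by
  rw [balances_iff] at h
  rw [isSigned_iff] at ha hb
  have h1 := Tmax.zero_le' (plus a)
  have h2 := Tmax.zero_le' (minus a)
  have h3 := Tmax.zero_le' (plus b)
  have h4 := Tmax.zero_le' (minus b)
  apply ext_plus_minus <;> grind

theorem balances_refl {a : Smax Γ} : Balances a a := by
  rw [balances_iff, max_comm]

theorem Surpass.mul {a : Smax Γ} (h : Surpass 0 a) (b : Smax Γ) : Surpass 0 (b * a) := by
  obtain ⟨x, y, rfl⟩ := mk_surjective a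
  obtain ⟨z, w, rfl⟩ := mk_surjective b
  rw [surpass_zero_mk] at h
  rw [mk_mul_mk, surpass_zero_mk, h, add_comm]

theorem Balances.mul {a b : Smax Γ} (h : Balances a b) (c : Smax Γ) :
    Balances (c * a) (c * b) := by
  unfold Balances at h ⊢
  rw [← Smax.mul_neg, ← mul_add]
  exact Surpass.mul h c

end Smax

/-! ### Sign changes of sequences of signs -/

namespace SignSeq

/-- The positions of the sign changes of a sequence of signs. -/
def changes (p : ℕ → SignType) : Set ℕ :=
  {i | ∃ k : ℕ, 1 ≤ k ∧ p i = -(p (i + k)) ∧ p (i + k) ≠ 0 ∧ ∀ j, i < j → j < i + k → p j = 0}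

/-- The balance relation `s ∇ a ⊖ b` for signs. -/
def Bal (s a b : SignType) : Prop := (a = b → a = 0) → s = if a = 0 then -b else a

/-- The first non-zero sign among the `d` terms that start at the position `k`. -/
def firstSign (p : ℕ → SignType) : ℕ → ℕ → SignType
  | _, 0 => 0
  | k, d + 1 => if p k = 0 then firstSign p (k + 1) d else p k

/-- The number of sign changes among the `d` terms that start at the position `k`. -/
def count (p : ℕ → SignType) : ℕ → ℕ → ℕ
  | _, 0 => 0
  | k, d + 1 => count p (k + 1) d + if p k ≠ 0 ∧ p k = -firstSign p (k + 1) d then 1 else 0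

theorem firstSign_eq_zero {p : ℕ → SignType} {k d : ℕ} (h : firstSign p k d = 0) :
    ∀ j, k ≤ j → j < k + d → p j = 0 := by
  induction d generalizing k with
  | zero => intro j h1 h2; omega
  | succ d ih =>
    intro j h1 h2
    rw [firstSign] at h
    split_ifs at h with hk
    · rcases h1.eq_or_lt with rfl | h1
      · exact hk
      · exact ih h j h1 (by omega)
    · exact absurd h hk

theorem firstSign_spec {p : ℕ → SignType} {k d : ℕ} (h : firstSign p k d ≠ 0) :
    ∃ j, k ≤ j ∧ p j = firstSign p k d ∧ ∀ l, k ≤ l → l < j → p l = 0 := by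
  induction d generalizing k with
  | zero => exact absurd rfl h
  | succ d ih =>
    rw [firstSign] at h ⊢
    split_ifs at h ⊢ with hk
    · obtain ⟨j, h1, h2, h3⟩ := ih h
      refine ⟨j, by omega, h2, fun l hl hl' => ?_⟩
      rcases hl.eq_or_lt with rfl | hl
      · exact hk
      · exact h3 l hl hl'
    · exact ⟨k, le_rfl, rfl, fun l hl hl' => by omega⟩

/-- The second term of a sign change is forced to be the first non-zero term after it; this makes
the number of changes computable by recursion from the right. -/
theorem mem_changes_iff {p : ℕ → SignType} {k d : ℕ} (hp : ∀ j, k + 1 + d ≤ j → p j = 0) :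
    k ∈ changes p ↔ p k ≠ 0 ∧ p k = -firstSign p (k + 1) d := by
  constructor
  · rintro ⟨m, hm, h1, h2, h3⟩
    refine ⟨by rw [h1]; revert h2; cases p (k + m) <;> decide, ?_⟩
    by_cases h : firstSign p (k + 1) d = 0
    · exact absurd (firstSign_eq_zero h (k + m) (by omega)
        (by by_contra hc; exact h2 (hp _ (by omega)))) h2
    · obtain ⟨j, e1, e2, e3⟩ := firstSign_spec h
      have : j = k + m := by
        rcases lt_trichotomy j (k + m) with hj | hj | hj
        · exact absurd (e2 ▸ h3 j (by omega) hj) h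
        · exact hj
        · exact absurd (e3 (k + m) (by omega) hj) h2
      rw [← e2, this, h1]
  · rintro ⟨h1, h2⟩
    have h : firstSign p (k + 1) d ≠ 0 := by
      intro h; rw [h] at h2; exact h1 h2
    obtain ⟨j, e1, e2, e3⟩ := firstSign_spec h
    obtain ⟨m, rfl⟩ := Nat.exists_eq_add_of_le (show k ≤ j by omega)
    exact ⟨m, by omega, by rw [h2, e2], by rwa [e2], fun l hl hl' => e3 l hl hl'⟩

theorem encard_changes_Ici {p : ℕ → SignType} {k d : ℕ} (hp : ∀ j, k + d ≤ j → p j = 0) :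
    (changes p ∩ Set.Ici k).encard = count p k d := by
  induction d generalizing k with
  | zero =>
    rw [count, Nat.cast_zero, Set.encard_eq_zero]
    ext i
    simp only [Set.mem_inter_iff, Set.mem_Ici, Set.mem_empty_iff_false, iff_false, not_and]
    rintro ⟨m, -, -, h, -⟩ hk
    exact h (hp _ (by omega))
  | succ d ih =>
    have hp' : ∀ j, k + 1 + d ≤ j → p j = 0 := fun j hj => hp j (by omega)
    rw [count, Nat.cast_add, ← ih hp']
    split_ifs with h <;> rw [← mem_changes_iff hp'] at h
    · have : changes p ∩ Set.Ici k = insert k (changes p ∩ Set.Ici (k + 1)) := by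
        ext i
        simp only [Set.mem_inter_iff, Set.mem_Ici, Set.mem_insert_iff]
        constructor
        · rintro ⟨h1, h2⟩
          by_cases hi : i = k
          · exact Or.inl hi
          · exact Or.inr ⟨h1, by omega⟩
        · rintro (rfl | ⟨h1, h2⟩)
          · exact ⟨h, le_rfl⟩
          · exact ⟨h1, by omega⟩
      rw [this, Set.encard_insert_of_notMem (by simp), Nat.cast_one]
    · rw [Nat.cast_zero, add_zero]
      congr 1
      ext i
      simp only [Set.mem_inter_iff, Set.mem_Ici]
      constructor
      · rintro ⟨h1, h2⟩
        exact ⟨h1, lt_of_le_of_ne h2 (by rintro rfl; exact h h1)⟩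
      · rintro ⟨h1, h2⟩
        exact ⟨h1, by omega⟩

theorem encard_changes {p : ℕ → SignType} {d : ℕ} (hp : ∀ j, d ≤ j → p j = 0) :
    (changes p).encard = count p 0 d := by
  rw [← encard_changes_Ici (k := 0) (d := d) (by simpa using hp)]
  congr 1
  ext i
  simp

theorem encard_changes_ne_top {p : ℕ → SignType} {d : ℕ} (hp : ∀ j, d ≤ j → p j = 0) :
    (changes p).encard ≠ ⊤ := by
  rw [encard_changes hp]
  exact ENat.natCast_ne_top _

theorem changes_neg (p : ℕ → SignType) : changes (fun i => -p i) = changes p := by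
  ext i
  simp only [changes, Set.mem_ofPred_eq, neg_inj, ne_eq, SignType.neg_eq_zero_iff]

theorem changes_nonempty {p : ℕ → SignType} {i j : ℕ} (hi : p i = 1) (hj : p j = -1) :
    (changes p).Nonempty := by
  by_contra hne
  rw [Set.not_nonempty_iff_eq_empty] at hne
  -- Induction on the distance of two opposite terms: either only zeros lie between them, which is a
  -- change, or a non-zero term between them is opposite to one of the two, at a smaller distance.
  have key : ∀ a m, p a ≠ 0 → p (a + m) = -p a → False := by
    intro a m
    induction m using Nat.strong_induction_on generalizing a with
    | _ m ih =>
      intro ha hm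
      by_cases hz : ∀ l, a < l → l < a + m → p l = 0
      · have : a ∈ changes p := by
          refine ⟨m, ?_, ?_, ?_, hz⟩
          · rcases Nat.eq_zero_or_pos m with rfl | h
            · rw [add_zero] at hm
              revert ha hm; cases p a <;> decide
            · exact h
          · rw [hm]; cases p a <;> decide
          · rw [hm]; revert ha; cases p a <;> decide
        rw [hne] at this
        exact this
      · push Not at hz
        obtain ⟨l, h1, h2, h3⟩ := hz
        obtain ⟨b, rfl⟩ := Nat.exists_eq_add_of_lt h1
        have hcase : p (a + b + 1) = p a ∨ p (a + b + 1) = -p a := by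
          revert h3 ha
          cases p (a + b + 1) <;> cases p a <;> decide
        rcases hcase with e | e
        · refine ih (m - (b + 1)) (by omega) (a + b + 1) h3 ?_
          rw [show a + b + 1 + (m - (b + 1)) = a + m by omega, hm, e]
        · exact ih (b + 1) (by omega) a ha e
  rcases le_total i j with h | h
  · obtain ⟨m, rfl⟩ := Nat.exists_eq_add_of_le h
    exact key i m (by rw [hi]; decide) (by rw [hi, hj])
  · obtain ⟨m, rfl⟩ := Nat.exists_eq_add_of_le h
    exact key j m (by rw [hj]; decide) (by rw [hi, hj]; decide)

/-- One step to the left in `count_succ_le`, as a finite check: `s` is the new term of `p`, `a` the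
new term of `q` and `b` the next term of `q`; `u`, `v` are the first signs and `c'`, `c` the counts
of the tails of `p`, `q`. -/
theorem bal_step {s a b u v : SignType} {c c' : ℕ} (hB : Bal s a b)
    (h1 : v = 0 → u = 0 ∧ c' = 0 ∧ c = 0) (h2 : v ≠ 0 → c < c' ∨ (c = c' ∧ u = v))
    (h3 : b = 0 → v ≠ 0 → c < c') (h4 : b ≠ 0 → v = b) :
    ((if a = 0 then v else a) = 0 → (if s = 0 then u else s) = 0 ∧
      (c' + if s ≠ 0 ∧ s = -u then 1 else 0) = 0 ∧ (c + if a ≠ 0 ∧ a = -v then 1 else 0) = 0) ∧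
    ((if a = 0 then v else a) ≠ 0 →
      (c + if a ≠ 0 ∧ a = -v then 1 else 0) < (c' + if s ≠ 0 ∧ s = -u then 1 else 0) ∨
      ((c + if a ≠ 0 ∧ a = -v then 1 else 0) = (c' + if s ≠ 0 ∧ s = -u then 1 else 0) ∧
        (if s = 0 then u else s) = if a = 0 then v else a)) ∧
    (a = 0 → (if a = 0 then v else a) ≠ 0 →
      (c + if a ≠ 0 ∧ a = -v then 1 else 0) < (c' + if s ≠ 0 ∧ s = -u then 1 else 0)) := by
  revert hB
  cases s <;> cases a <;> cases b <;> cases u <;> cases v <;>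
    simp [Bal] at h1 h2 h3 h4 ⊢ <;> omega

theorem count_succ_le {p q : ℕ → SignType} {N : ℕ} (h0 : Bal (p 0) 0 (q 0))
    (hB : ∀ k, Bal (p (k + 1)) (q k) (q (k + 1))) (hq : ∀ k, N ≤ k → q k = 0)
    {m : ℕ} (hm : q m ≠ 0) : count q 0 N + 1 ≤ count p 0 (N + 1) := by
  have key : ∀ d k, k + d = N →
      (firstSign q k d = 0 → firstSign p (k + 1) d = 0 ∧ count p (k + 1) d = 0 ∧
        count q k d = 0) ∧
      (firstSign q k d ≠ 0 → count q k d < count p (k + 1) d ∨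
        (count q k d = count p (k + 1) d ∧ firstSign p (k + 1) d = firstSign q k d)) ∧
      (q k = 0 → firstSign q k d ≠ 0 → count q k d < count p (k + 1) d) := by
    intro d
    induction d with
    | zero => intro k _; simp [firstSign, count]
    | succ d ih =>
      intro k hk
      obtain ⟨h1, h2, h3⟩ := ih (k + 1) (by omega)
      refine bal_step (hB k) h1 h2 h3 ?_
      intro hne
      cases d with
      | zero => exact absurd (hq (k + 1) (by omega)) hne
      | succ d => rw [firstSign, if_neg hne]
  obtain ⟨h1, h2, h3⟩ := key N 0 (by omega)
  have hne : firstSign q 0 N ≠ 0 := fun h =>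
    hm (firstSign_eq_zero h m (Nat.zero_le _) (by by_contra hc; exact hm (hq m (by omega))))
  rw [count]
  by_cases hq0 : q 0 = 0
  · have := h3 hq0 hne
    omega
  · have hp : p 0 = -q 0 := by
      have := h0 (fun _ => rfl)
      rwa [if_pos rfl] at this
    have hf : firstSign q 0 N = q 0 := by
      cases N with
      | zero => exact absurd rfl hne
      | succ N => rw [firstSign, if_neg hq0]
    rcases h2 hne with h | ⟨h, h'⟩
    · omega
    · rw [if_pos, h]
      rw [hp, h', hf]
      refine ⟨?_, rfl⟩
      revert hq0
      cases q 0 <;> decide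

theorem encard_changes_succ_le {p q : ℕ → SignType} {N : ℕ} (h0 : Bal (p 0) 0 (q 0))
    (hB : ∀ k, Bal (p (k + 1)) (q k) (q (k + 1))) (hq : ∀ k, N ≤ k → q k = 0)
    {m : ℕ} (hm : q m ≠ 0) (hp : ∀ k, N + 1 ≤ k → p k = 0) :
    (changes q).encard + 1 ≤ (changes p).encard := by
  rw [encard_changes hq, encard_changes hp]
  exact_mod_cast count_succ_le h0 hB hq hm

end SignSeq

/-! ### Signs at the maximal level, and the root one -/

namespace Smax

open Polynomial SignSeq

variable {Γ : Type*} [AddCommGroup Γ] [LinearOrder Γ] [IsOrderedAddMonoid Γ]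

/-- The sign of an element of absolute value `M`, and `0` for the other elements. -/
def level (M : Tmax Γ) (a : Smax Γ) : SignType :=
  if plus a = M then 1 else if minus a = M then -1 else 0

/-- For `M = ⊥` this fails, since `level ⊥ 0 = 1`. -/
theorem level_neg {M : Tmax Γ} (hM : M ≠ 0) {a : Smax Γ} (ha : IsSigned a) :
    level M (-a) = -level M a := by
  rw [isSigned_iff] at ha
  unfold level
  rw [plus_neg, minus_neg]
  split_ifs with h1 h2 <;> first | rfl | grind

theorem level_eq_zero_iff {M : Tmax Γ} (hM : M ≠ 0) {a : Smax Γ} (ha : IsSigned a) :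
    level M a = 0 ↔ absHom a ≠ M := by
  rw [isSigned_iff] at ha
  have h1 := Tmax.zero_le' (plus a)
  have h2 := Tmax.zero_le' (minus a)
  unfold level
  rw [absHom_eq_max]
  split_ifs <;> simp <;> grind

theorem level_zero {M : Tmax Γ} (hM : M ≠ 0) : level M (0 : Smax Γ) = 0 := by
  rw [level_eq_zero_iff hM isSigned_zero, map_zero]
  exact hM.symm

theorem plus_ofT_mul {c : Tmax Γ} (hc : c ≠ 0) (a : Smax Γ) : plus (ofT c * a) = c * plus a := by
  obtain ⟨x, y, rfl⟩ := mk_surjective a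
  change plus (mk c 0 * mk x y) = _
  rw [mk_mul_mk, zero_mul, zero_mul, add_zero, add_zero, plus_mk, plus_mk]
  by_cases h : y ≤ x
  · rw [if_pos h, if_pos (Tmax.mul_le_mul_left' h c)]
  · rw [if_neg h, if_neg (not_le.2 (Tmax.mul_lt_mul_left' (not_le.1 h) hc)), mul_zero]

theorem minus_ofT_mul {c : Tmax Γ} (hc : c ≠ 0) (a : Smax Γ) :
    minus (ofT c * a) = c * minus a := by
  rw [minus, ← Smax.mul_neg, plus_ofT_mul hc]
  rfl

theorem level_ofT_mul {c : Tmax Γ} (hc : c ≠ 0) (M : Tmax Γ) (a : Smax Γ) :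
    level (c * M) (ofT c * a) = level M a := by
  simp only [level, plus_ofT_mul hc, minus_ofT_mul hc, mul_right_inj' hc]

/-- Unless `a` and `b` have the same non-zero sign at level `M`, the level-`M` part of `a ⊖ b` is
zero or signed, and it then determines that of `s`. If they do have the same sign, `a ⊖ b` is
balanced and `Bal` says nothing. -/
theorem bal_level {M : Tmax Γ} (hM : M ≠ 0) {s a b : Smax Γ} (hs : IsSigned s)
    (ha : IsSigned a) (hb : IsSigned b) (ha' : absHom a ≤ M) (hb' : absHom b ≤ M)
    (h : Balances s (a + -b)) : Bal (level M s) (level M a) (level M b) := by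
  rw [balances_add_iff, plus_neg, minus_neg] at h
  rw [isSigned_iff] at hs ha hb
  rw [absHom_eq_max] at ha' hb'
  have h1 := Tmax.zero_le' (plus a)
  have h2 := Tmax.zero_le' (minus a)
  have h3 := Tmax.zero_le' (plus b)
  have h4 := Tmax.zero_le' (minus b)
  have h5 := Tmax.zero_le' (plus s)
  have h6 := Tmax.zero_le' (minus s)
  have hM' : 0 < M := lt_of_le_of_ne (Tmax.zero_le' M) hM.symm
  unfold level Bal
  generalize plus a = x at *
  generalize minus a = x' at *
  generalize plus b = y at *
  generalize minus b = y' at *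
  generalize plus s = z at *
  generalize minus s = z' at *
  generalize (0 : Tmax Γ) = o at *
  rcases ha with rfl | rfl <;> rcases hb with rfl | rfl <;> rcases hs with rfl | rfl <;>
    split_ifs <;> first | decide | grind

theorem absHom_le_of_balances {s a b : Smax Γ} (hs : IsSigned s)
    (h : Balances s (a + -b)) : absHom s ≤ max (absHom a) (absHom b) := by
  rw [balances_add_iff, plus_neg, minus_neg] at h
  rw [isSigned_iff] at hs
  rw [absHom_eq_max, absHom_eq_max, absHom_eq_max]
  have h1 := Tmax.zero_le' (plus a)
  have h2 := Tmax.zero_le' (plus b)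
  have h3 := Tmax.zero_le' (minus a)
  have h4 := Tmax.zero_le' (minus b)
  grind

theorem le_absHom_of_balances {s a b : Smax Γ} (ha : IsSigned a)
    (hab : absHom b < absHom a) (h : Balances s (a + -b)) : absHom a ≤ absHom s := by
  rw [balances_add_iff, plus_neg, minus_neg] at h
  rw [isSigned_iff] at ha
  rw [absHom_eq_max, absHom_eq_max] at *
  have h5 := Tmax.zero_le' (plus a)
  have h6 := Tmax.zero_le' (minus a)
  have h5 := Tmax.zero_le' (plus b)
  have h6 := Tmax.zero_le' (minus b)
  grind

/-- Addition in `Tmax` is the maximum, so `absHom (P.eval 1)` serves below as the maximal absolute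
value of the coefficients. -/
theorem absHom_eval_one (P : (Smax Γ)[X]) :
    absHom (P.eval 1) = ∑ i ∈ Finset.range (P.natDegree + 1), absHom (P.coeff i) := by
  rw [eval_eq_sum_range, map_sum]
  simp

theorem absHom_coeff_le (P : (Smax Γ)[X]) (i : ℕ) : absHom (P.coeff i) ≤ absHom (P.eval 1) := by
  by_cases hi : i ≤ P.natDegree
  · rw [absHom_eval_one]
    exact Tmax.le_sum _ (fun i => absHom (P.coeff i)) (Finset.mem_range.2 (by omega))
  · rw [coeff_eq_zero_of_natDegree_lt (by omega), map_zero]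
    exact Tmax.zero_le' _

theorem absHom_eval_one_ne_zero {P : (Smax Γ)[X]} (hP : P ≠ 0) : absHom (P.eval 1) ≠ 0 := by
  intro h
  apply hP
  ext i
  rw [coeff_zero, ← absHom_eq_zero_iff]
  exact le_antisymm (h ▸ absHom_coeff_le P i) (Tmax.zero_le' _)

theorem exists_absHom_coeff {P : (Smax Γ)[X]} (hP : P ≠ 0) :
    ∃ i ≤ P.natDegree, absHom (P.coeff i) = absHom (P.eval 1) := by
  have h := absHom_eval_one_ne_zero hP
  rw [absHom_eval_one] at h ⊢
  obtain ⟨i, hi, e⟩ := Tmax.exists_eq_sum _ _ h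
  exact ⟨i, Nat.lt_succ_iff.1 (Finset.mem_range.1 hi), e⟩

theorem absHom_eval_one_le {P : (Smax Γ)[X]} {M : Tmax Γ} (h : ∀ i, absHom (P.coeff i) ≤ M) :
    absHom (P.eval 1) ≤ M := by
  by_cases hP : P = 0
  · rw [hP, eval_zero, map_zero]
    exact Tmax.zero_le' _
  · obtain ⟨i, -, e⟩ := exists_absHom_coeff hP
    exact e ▸ h i

/-- The signs of the coefficients of maximal absolute value. -/
noncomputable def signs (P : (Smax Γ)[X]) (i : ℕ) : SignType :=
  level (absHom (P.eval 1)) (P.coeff i)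

theorem signs_eq_zero {P : (Smax Γ)[X]} (hP : P ≠ 0) {i : ℕ} (hi : P.natDegree < i) :
    signs P i = 0 := by
  rw [signs, coeff_eq_zero_of_natDegree_lt hi, level_zero (absHom_eval_one_ne_zero hP)]

theorem sum_mk {ι : Type*} (s : Finset ι) (f g : ι → Tmax Γ) :
    ∑ i ∈ s, mk (f i) (g i) = mk (∑ i ∈ s, f i) (∑ i ∈ s, g i) := by
  classical
  induction s using Finset.induction_on with
  | empty => rfl
  | insert a s ha ih => rw [Finset.sum_insert ha, Finset.sum_insert ha, Finset.sum_insert ha, ih,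
      mk_add_mk]

theorem level_eq_one_iff {M : Tmax Γ} {a : Smax Γ} : level M a = 1 ↔ plus a = M := by
  unfold level
  split_ifs <;> simp_all

theorem level_eq_neg_one_iff {M : Tmax Γ} (hM : M ≠ 0) {a : Smax Γ} (ha : IsSigned a) :
    level M a = -1 ↔ minus a = M := by
  have := level_neg hM ha
  rw [← plus_neg, ← level_eq_one_iff, this]
  cases level M a <;> decide

/-- The value at `1` is balanced exactly when the maximal absolute value is attained both by a
positive and by a negative coefficient. -/
theorem isRootOf_one_iff {P : (Smax Γ)[X]} (hP : SignedPoly P) (hP0 : P ≠ 0) :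
    IsRootOf 1 P ↔ (changes (signs P)).Nonempty := by
  have hM := absHom_eval_one_ne_zero hP0
  have e : P.eval 1 = mk (∑ i ∈ Finset.range (P.natDegree + 1), plus (P.coeff i))
      (∑ i ∈ Finset.range (P.natDegree + 1), minus (P.coeff i)) := by
    rw [eval_eq_sum_range, ← sum_mk]
    simp [mk_plus_minus]
  have hle (i : ℕ) := absHom_coeff_le P i
  simp only [absHom_eq_max (P.coeff _), max_le_iff] at hle
  have hmax : absHom (P.eval 1) = max (∑ i ∈ Finset.range (P.natDegree + 1), plus (P.coeff i))
      (∑ i ∈ Finset.range (P.natDegree + 1), minus (P.coeff i)) := by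
    rw [e]; rfl
  unfold IsRootOf
  rw [e, surpass_zero_mk]
  constructor
  · intro h
    have hp : ∑ i ∈ Finset.range (P.natDegree + 1), plus (P.coeff i) = absHom (P.eval 1) := by
      rw [hmax, ← h, max_self]
    have hm : ∑ i ∈ Finset.range (P.natDegree + 1), minus (P.coeff i) = absHom (P.eval 1) := by
      rw [hmax, ← h, max_self]
    obtain ⟨i, -, hi⟩ := Tmax.exists_eq_sum _ _ (hp ▸ hM)
    obtain ⟨j, -, hj⟩ := Tmax.exists_eq_sum _ _ (hm ▸ hM)
    exact changes_nonempty (level_eq_one_iff.2 (hi.trans hp))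
      ((level_eq_neg_one_iff hM (hP j)).2 (hj.trans hm))
  · have key : ∀ i j, signs P i = 1 → signs P j = -1 →
        ∑ i ∈ Finset.range (P.natDegree + 1), plus (P.coeff i) =
          ∑ i ∈ Finset.range (P.natDegree + 1), minus (P.coeff i) := by
      intro i j hi hj
      have hi' : i ∈ Finset.range (P.natDegree + 1) := by
        rw [Finset.mem_range]
        by_contra hc
        rw [signs_eq_zero hP0 (by omega)] at hi
        exact absurd hi (by decide)
      have hj' : j ∈ Finset.range (P.natDegree + 1) := by
        rw [Finset.mem_range]
        by_contra hc
        rw [signs_eq_zero hP0 (by omega)] at hj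
        exact absurd hj (by decide)
      have h1 := Tmax.le_sum _ (fun i => plus (P.coeff i)) hi'
      have h2 := Tmax.le_sum _ (fun i => minus (P.coeff i)) hj'
      simp only [level_eq_one_iff.1 hi, (level_eq_neg_one_iff hM (hP j)).1 hj, hmax] at h1 h2
      exact le_antisymm ((le_max_left _ _).trans h2) ((le_max_right _ _).trans h1)
    rintro ⟨i, k, -, h1, h2, -⟩
    cases hk : signs P (i + k) with
    | zero => exact absurd hk h2
    | pos => exact key (i + k) i hk (by rw [h1, hk]; decide)
    | neg => exact key i (i + k) (by rw [h1, hk]; decide) hk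

/-! ### Upper bound: a quotient loses at least one sign change -/

theorem coeff_zero_X_add_C_mul (a : Smax Γ) (Q : (Smax Γ)[X]) :
    ((X + C (-a)) * Q).coeff 0 = -(a * Q.coeff 0) := by
  rw [mul_coeff_zero]
  simp [Smax.neg_mul]

theorem coeff_succ_X_add_C_mul (a : Smax Γ) (Q : (Smax Γ)[X]) (k : ℕ) :
    ((X + C (-a)) * Q).coeff (k + 1) = Q.coeff k + -(a * Q.coeff (k + 1)) := by
  rw [add_mul, coeff_add, coeff_X_mul, coeff_C_mul, Smax.neg_mul]

theorem polyBalances_one_iff (P Q : (Smax Γ)[X]) : PolyBalances P ((X + C (-1)) * Q) ↔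
    Balances (P.coeff 0) (0 + -Q.coeff 0) ∧
      ∀ k, Balances (P.coeff (k + 1)) (Q.coeff k + -Q.coeff (k + 1)) := by
  constructor
  · intro h
    refine ⟨?_, fun k => ?_⟩
    · have := h 0
      rwa [coeff_zero_X_add_C_mul, one_mul, ← zero_add (-Q.coeff 0)] at this
    · have := h (k + 1)
      rwa [coeff_succ_X_add_C_mul, one_mul] at this
  · rintro ⟨h0, h1⟩ (_ | k)
    · rwa [coeff_zero_X_add_C_mul, one_mul, ← zero_add (-Q.coeff 0)]
    · rw [coeff_succ_X_add_C_mul, one_mul]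
      exact h1 k

theorem absHom_eval_one_eq_of_polyBalances {P Q : (Smax Γ)[X]} (hP : SignedPoly P)
    (hQ : SignedPoly Q) (hQ0 : Q ≠ 0) (h : PolyBalances P ((X + C (-1)) * Q)) :
    absHom (P.eval 1) = absHom (Q.eval 1) := by
  classical
  rw [polyBalances_one_iff] at h
  apply le_antisymm
  · refine absHom_eval_one_le ?_
    rintro (_ | k)
    · refine (absHom_le_of_balances (hP 0) h.1).trans (max_le ?_ (absHom_coeff_le Q 0))
      rw [map_zero]
      exact Tmax.zero_le' _
    · exact (absHom_le_of_balances (hP _) (h.2 k)).trans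
        (max_le (absHom_coeff_le Q _) (absHom_coeff_le Q _))
  · obtain ⟨i, hi, e⟩ := exists_absHom_coeff hQ0
    -- At the last index `m` where `Q` attains its maximum, the term `Q.coeff (m + 1)` is strictly
    -- smaller and cannot cancel it, so the maximum reappears in `P.coeff (m + 1)`.
    obtain ⟨m, hm, hgt⟩ : ∃ m, absHom (Q.coeff m) = absHom (Q.eval 1) ∧
        ∀ k, m < k → k ≤ Q.natDegree → absHom (Q.coeff k) ≠ absHom (Q.eval 1) :=
      ⟨_, Nat.findGreatest_spec (P := fun i => absHom (Q.coeff i) = absHom (Q.eval 1)) hi e,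
        fun k => Nat.findGreatest_is_greatest⟩
    have hlt : absHom (Q.coeff (m + 1)) < absHom (Q.coeff m) := by
      rw [hm]
      refine lt_of_le_of_ne (absHom_coeff_le Q _) fun h' => ?_
      by_cases hd : m + 1 ≤ Q.natDegree
      · exact hgt (m + 1) (Nat.lt_succ_self m) hd h'
      · rw [coeff_eq_zero_of_natDegree_lt (by omega), map_zero] at h'
        exact absHom_eval_one_ne_zero hQ0 h'.symm
    rw [← hm]
    exact (le_absHom_of_balances (hQ m) hlt (h.2 m)).trans (absHom_coeff_le P _)

theorem encard_changes_signs_succ_le {P Q : (Smax Γ)[X]} (hP : SignedPoly P) (hP0 : P ≠ 0)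
    (hQ : SignedPoly Q) (hQ0 : Q ≠ 0) (h : PolyBalances P ((X + C (-1)) * Q)) :
    (changes (signs Q)).encard + 1 ≤ (changes (signs P)).encard := by
  have e := absHom_eval_one_eq_of_polyBalances hP hQ hQ0 h
  have hM := absHom_eval_one_ne_zero hQ0
  rw [polyBalances_one_iff] at h
  obtain ⟨m, -, hm⟩ := exists_absHom_coeff hQ0
  refine encard_changes_succ_le (N := max P.natDegree Q.natDegree + 1) (m := m) ?_ ?_ ?_ ?_ ?_
  · have := bal_level hM (hP 0) isSigned_zero (hQ 0) (by rw [map_zero]; exact Tmax.zero_le' _)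
      (absHom_coeff_le Q 0) h.1
    rw [level_zero hM, ← e] at this
    rwa [signs, signs, ← e]
  · intro k
    rw [signs, signs, signs, e]
    exact bal_level hM (hP _) (hQ _) (hQ _) (absHom_coeff_le Q _) (absHom_coeff_le Q _) (h.2 k)
  · intro k hk
    exact signs_eq_zero hQ0 (by omega)
  · rw [signs, Ne, level_eq_zero_iff hM (hQ m), not_not, hm]
  · intro k hk
    exact signs_eq_zero hP0 (by omega)

theorem signs_ofT_mul {c : Tmax Γ} (hc : c ≠ 0) (P : (Smax Γ)[X]) :
    signs (C (ofT c) * P) = signs P := by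
  funext i
  rw [signs, eval_mul, eval_C, coeff_C_mul, map_mul, absHom_ofT, level_ofT_mul hc, signs]

theorem changes_signs_C_mul {l : Smax Γ} (hl : IsTangible l) {P : (Smax Γ)[X]}
    (hP : SignedPoly P) (hP0 : P ≠ 0) : changes (signs (C l * P)) = changes (signs P) := by
  obtain ⟨c, hc⟩ := hl.1.exists_ofT
  have hc0 : c ≠ 0 := by
    rintro rfl
    rcases hc with rfl | rfl <;> exact hl.2 (by simp only [map_zero, Smax.neg_zero])
  rcases hc with rfl | rfl
  · rw [signs_ofT_mul hc0]
  · rw [← signs_ofT_mul hc0 P, ← changes_neg]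
    congr 1
    funext i
    rw [signs, signs, eval_mul, eval_C, coeff_C_mul, eval_mul, eval_C, coeff_C_mul, Smax.neg_mul,
      Smax.neg_mul, absHom_neg, level_neg, neg_neg]
    · rw [map_mul, absHom_ofT]
      exact mul_ne_zero hc0 (absHom_eval_one_ne_zero hP0)
    · exact (isSigned_ofT c).mul (hP i)

/-! ### Lower bound: a quotient that loses only one sign change -/

theorem balances_add_neg_self {s a : Smax Γ} (h : absHom s ≤ absHom a) :
    Balances s (a + -a) := by
  rw [balances_add_iff, plus_neg, minus_neg]
  rw [absHom_eq_max, absHom_eq_max] at h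
  grind

theorem balances_self_add {s b : Smax Γ} (hs : IsSigned s) (h : absHom b ≤ absHom s) :
    Balances s (s + b) := by
  rw [balances_add_iff]
  rw [absHom_eq_max, absHom_eq_max] at h
  rw [isSigned_iff] at hs
  have h1 := Tmax.zero_le' (plus s)
  have h2 := Tmax.zero_le' (minus s)
  have h3 := Tmax.zero_le' (plus b)
  have h4 := Tmax.zero_le' (minus b)
  grind

theorem eq_of_level_eq {M : Tmax Γ} (hM : M ≠ 0) {a b : Smax Γ} (ha : IsSigned a)
    (hb : IsSigned b) (h : level M a = level M b) (h0 : level M b ≠ 0) : a = b := by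
  rw [isSigned_iff] at ha hb
  unfold level at h h0
  apply ext_plus_minus <;> split_ifs at h h0 <;> grind

/-- The solution of the relations `p (k + 1) ∇ u k ⊖ u (k + 1)` that follows the last term of
maximal absolute value. -/
noncomputable def upSeq (p : ℕ → Smax Γ) : ℕ → Smax Γ
  | 0 => -p 0
  | k + 1 => if absHom (upSeq p k) ≤ absHom (p (k + 1)) then -p (k + 1) else upSeq p k

/-- The solution of the relations `p (k + 1) ∇ u k ⊖ u (k + 1)` that follows the next term of
maximal absolute value, among the `d` terms after the position `k`. -/
noncomputable def downSeq (p : ℕ → Smax Γ) : ℕ → ℕ → Smax Γ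
  | _, 0 => 0
  | k, d + 1 => if absHom (downSeq p (k + 1) d) ≤ absHom (p (k + 1)) then p (k + 1)
      else downSeq p (k + 1) d

theorem exists_downSeq (p : ℕ → Smax Γ) {N : ℕ} (hp : ∀ k, N < k → p k = 0) :
    ∃ u : ℕ → Smax Γ, (∀ k, N ≤ k → u k = 0) ∧
      ∀ k, u k = if absHom (u (k + 1)) ≤ absHom (p (k + 1)) then p (k + 1) else u (k + 1) := by
  refine ⟨fun k => downSeq p k (N - k), fun k hk => ?_, fun k => ?_⟩
  · simp only [Nat.sub_eq_zero_of_le hk, downSeq]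
  · by_cases hk : N ≤ k
    · simp only [Nat.sub_eq_zero_of_le hk, Nat.sub_eq_zero_of_le (hk.trans (Nat.le_succ k)),
        downSeq, hp (k + 1) (by omega), ite_self]
    · have : N - k = (N - (k + 1)) + 1 := by omega
      simp only [this, downSeq]

theorem exists_coeff_eq (f : ℕ → Smax Γ) {N : ℕ} (hf : ∀ k, N ≤ k → f k = 0) :
    ∃ Q : (Smax Γ)[X], ∀ k, Q.coeff k = f k := by
  refine ⟨∑ k ∈ Finset.range N, monomial k (f k), fun k => ?_⟩
  simp only [finsetSum_coeff, coeff_monomial, Finset.sum_ite_eq', Finset.mem_range]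
  split_ifs with h
  · rfl
  · rw [hf k (by omega)]

/-- `upSeq` and a sequence from `exists_downSeq` both solve the inner relations. They are glued at
the first sign change `i`, where the next dominant coefficient is `⊖ P_i`, so that the two
prescriptions fit together. Beyond `i`, every change of `P` at `a` yields a change of `Q` at `a -
1`, so only the change at `i` can be lost. -/
theorem exists_polyBalances {P : (Smax Γ)[X]} (hP : SignedPoly P) (hP0 : P ≠ 0)
    (hc : (changes (signs P)).Nonempty) :
    ∃ Q : (Smax Γ)[X], SignedPoly Q ∧ PolyBalances P ((X + C (-1)) * Q) ∧
      (changes (signs P)).encard ≤ (changes (signs Q)).encard + 1 := by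
  classical
  have hM := absHom_eval_one_ne_zero hP0
  have hi := Nat.find_spec hc
  have hmin : ∀ a ∈ changes (signs P), Nat.find hc ≤ a := fun a ha => Nat.find_min' hc ha
  generalize Nat.find hc = i at hi hmin
  obtain ⟨u, hu0, hu⟩ := exists_downSeq (N := P.natDegree) P.coeff
    (fun k hk => coeff_eq_zero_of_natDegree_lt hk)
  have hu_le : ∀ k, absHom (u k) ≤ absHom (P.eval 1) := by
    have : ∀ d k, P.natDegree ≤ k + d → absHom (u k) ≤ absHom (P.eval 1) := by
      intro d
      induction d with
      | zero => intro k hk; rw [hu0 k hk, map_zero]; exact Tmax.zero_le' _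
      | succ d ih =>
        intro k hk
        rw [hu]
        split_ifs
        exacts [absHom_coeff_le P _, ih (k + 1) (by omega)]
    exact fun k => this P.natDegree k (by omega)
  have hu_signed : ∀ k, IsSigned (u k) := by
    have : ∀ d k, P.natDegree ≤ k + d → IsSigned (u k) := by
      intro d
      induction d with
      | zero => intro k hk; rw [hu0 k hk]; exact isSigned_zero
      | succ d ih =>
        intro k hk
        rw [hu]
        split_ifs
        exacts [hP _, ih (k + 1) (by omega)]
    exact fun k => this P.natDegree k (by omega)
  have hu_bal : ∀ k, Balances (P.coeff (k + 1)) (u k + -u (k + 1)) := by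
    intro k
    rw [hu k]
    split_ifs with h
    · exact balances_self_add (hP _) (by rwa [absHom_neg])
    · exact balances_add_neg_self (not_le.1 h).le
  have habs : ∀ {b}, signs P b ≠ 0 → absHom (P.coeff b) = absHom (P.eval 1) := by
    intro b hb
    by_contra hne
    exact hb ((level_eq_zero_iff hM (hP b)).2 hne)
  have hu_eq : ∀ m k, signs P (k + m + 1) ≠ 0 → (∀ l, k < l → l < k + m + 1 → signs P l = 0) →
      u k = P.coeff (k + m + 1) := by
    intro m
    induction m with
    | zero =>
      intro k hk _
      rw [hu, add_zero, if_pos]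
      rw [add_zero] at hk
      rw [habs hk]
      exact hu_le _
    | succ m ih =>
      intro k hk hz
      have e : k + 1 + m + 1 = k + (m + 1) + 1 := by omega
      have := ih (k + 1) (by rwa [e]) (fun l hl hl' => hz l (by omega) (by omega))
      rw [e] at this
      rw [hu, this, if_neg]
      rw [habs hk, not_le]
      exact lt_of_le_of_ne (absHom_coeff_le P _)
        ((level_eq_zero_iff hM (hP _)).1 (hz (k + 1) (by omega) (by omega)))
  have hu_change : ∀ a ∈ changes (signs P), signs P a ≠ 0 ∧ u a = -P.coeff a := by
    rintro a ⟨k, hk, h1, h2, h3⟩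
    obtain ⟨m, rfl⟩ := Nat.exists_eq_add_of_le' hk
    have hne : signs P a ≠ 0 := by
      rw [h1]; revert h2; cases signs P (a + (m + 1)) <;> decide
    refine ⟨hne, ?_⟩
    rw [hu_eq m a h2 h3]
    refine eq_of_level_eq hM (hP _) (hP a).neg ?_ ?_
    · rw [level_neg hM (hP a)]
      change signs P (a + (m + 1)) = -signs P a
      rw [h1, neg_neg]
    · rw [level_neg hM (hP a)]
      change -signs P a ≠ 0
      rw [h1, neg_neg]
      exact h2
  have hi' : i < P.natDegree := by
    obtain ⟨k, hk, -, h2, -⟩ := hi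
    by_contra hc
    exact h2 (signs_eq_zero hP0 (by omega))
  have hup_signed : ∀ k, IsSigned (upSeq P.coeff k) := by
    intro k
    induction k with
    | zero => exact (hP 0).neg
    | succ k ih =>
      rw [upSeq]
      split_ifs
      exacts [(hP _).neg, ih]
  have hup_le : ∀ k, absHom (upSeq P.coeff k) ≤ absHom (P.eval 1) := by
    intro k
    induction k with
    | zero => rw [upSeq, absHom_neg]; exact absHom_coeff_le P 0
    | succ k ih =>
      rw [upSeq]
      split_ifs
      exacts [by rw [absHom_neg]; exact absHom_coeff_le P _, ih]
  obtain ⟨Q, hQ⟩ := exists_coeff_eq (N := P.natDegree)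
    (fun k => if k < i then upSeq P.coeff k else u k)
    (fun k hk => by rw [if_neg (by omega), hu0 k hk])
  obtain ⟨hne_i, hui⟩ := hu_change i hi
  have hQs : SignedPoly Q := by
    intro k
    rw [hQ]
    split_ifs
    exacts [hup_signed k, hu_signed k]
  have hbal : PolyBalances P ((X + C (-1)) * Q) := by
    rw [polyBalances_one_iff]
    refine ⟨?_, fun k => ?_⟩
    · have : Q.coeff 0 = -P.coeff 0 := by
        rw [hQ]
        split_ifs with h
        · rfl
        · obtain rfl : i = 0 := by omega
          exact hui
      rw [this, Smax.neg_neg, add_comm]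
      exact balances_self_add (hP 0) (by rw [map_zero]; exact Tmax.zero_le' _)
    · rw [hQ, hQ]
      by_cases h1 : k + 1 < i
      · rw [if_pos h1, if_pos (by omega), upSeq]
        split_ifs with h
        · rw [Smax.neg_neg, add_comm (upSeq P.coeff k)]
          exact balances_self_add (hP _) h
        · exact balances_add_neg_self (not_le.1 h).le
      · rw [if_neg h1]
        by_cases h2 : k < i
        · obtain rfl : i = k + 1 := by omega
          rw [if_pos h2, hui, Smax.neg_neg, add_comm (upSeq P.coeff k)]
          exact balances_self_add (hP _) (by rw [habs hne_i]; exact hup_le k)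
        · rw [if_neg h2]
          exact hu_bal k
  have hQ0 : Q ≠ 0 := by
    rintro rfl
    have := hQ i
    rw [if_neg (lt_irrefl i), hui, coeff_zero] at this
    apply absHom_eval_one_ne_zero hP0
    rw [← habs hne_i, ← absHom_neg, ← this, map_zero]
  refine ⟨Q, hQs, hbal, ?_⟩
  have e := absHom_eval_one_eq_of_polyBalances hP hQs hQ0 hbal
  have hsub : changes (signs P) ⊆ insert i (Nat.succ '' changes (signs Q)) := by
    intro a ha
    by_cases hai : a = i
    · exact Or.inl hai
    · have hlt : i < a := lt_of_le_of_ne (hmin a ha) (Ne.symm hai)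
      obtain ⟨b, rfl⟩ := Nat.exists_eq_add_of_lt hlt
      obtain ⟨h1, h2⟩ := hu_change _ ha
      -- Here `Q_{a-1} = P_a`, as `P_a` is dominant and comes next, and `Q_a = ⊖ P_a`: two adjacent
      -- opposite terms.
      refine Or.inr ⟨i + b, ⟨1, le_rfl, ?_, ?_, fun j _ _ => by omega⟩, rfl⟩
      · rw [signs, signs, hQ, hQ, if_neg (by omega), if_neg (by omega), h2, ← e,
          level_neg hM (hP _), neg_neg, hu_eq 0 (i + b) h1 (fun l _ _ => by omega), add_zero]
      · rw [signs, hQ, if_neg (by omega), h2, ← e, level_neg hM (hP _), Ne,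
          SignType.neg_eq_zero_iff]
        exact h1
  exact (Set.encard_le_encard hsub).trans ((Set.encard_insert_le _ _).trans
    (add_le_add (Set.encard_image_le _ _) le_rfl))

/-! ### Change of variable and the multiplicity of a non-zero root -/

theorem ne_zero_of_mem_quotients {a : Smax Γ} {P Q : (Smax Γ)[X]} (hP : SignedPoly P)
    (hP0 : P ≠ 0) (hQ : Q ∈ quotients a P) : Q ≠ 0 := by
  rintro rfl
  obtain ⟨-, l, hl, h⟩ := hQ
  apply hP0
  ext i
  have := h i
  rw [mul_zero, coeff_zero, coeff_C_mul] at this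
  have := this.eq (hl.1.mul (hP i)) isSigned_zero
  rw [coeff_zero]
  by_contra hne
  exact mul_ne_zero' hl.2 hne this

theorem signedPoly_comp {P : (Smax Γ)[X]} (hP : SignedPoly P) {t : Smax Γ} (ht : IsSigned t) :
    SignedPoly (P.comp (C t * X)) := by
  intro i
  rw [comp_C_mul_X_coeff]
  exact (hP i).mul (ht.pow i)

theorem signedPoly_C_mul {P : (Smax Γ)[X]} (hP : SignedPoly P) {t : Smax Γ} (ht : IsSigned t) :
    SignedPoly (C t * P) := by
  intro i
  rw [coeff_C_mul]
  exact ht.mul (hP i)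

theorem C_mul_ne_zero {P : (Smax Γ)[X]} (hP : P ≠ 0) {t : Smax Γ} (ht : t ≠ 0) :
    C t * P ≠ 0 := by
  intro h
  apply hP
  ext i
  rw [coeff_zero]
  by_contra hne
  apply mul_ne_zero' ht hne
  rw [← coeff_C_mul, h, coeff_zero]

theorem comp_ne_zero {P : (Smax Γ)[X]} (hP : P ≠ 0) {t : Smax Γ} (ht : t ≠ 0) :
    P.comp (C t * X) ≠ 0 := by
  intro h
  apply hP
  ext i
  rw [coeff_zero]
  by_contra hne
  apply mul_ne_zero' hne (pow_ne_zero' ht i)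
  rw [← comp_C_mul_X_coeff, h, coeff_zero]

theorem comp_comp_C_mul_X (P : (Smax Γ)[X]) {t t' : Smax Γ} (h : t * t' = 1) :
    (P.comp (C t * X)).comp (C t' * X) = P := by
  ext i
  rw [comp_C_mul_X_coeff, comp_C_mul_X_coeff, mul_assoc, ← mul_pow, h, one_pow, mul_one]

/-- Since `t Y ⊖ a = t (Y ⊖ a t')`, the substitution costs only a factor `t`, which is absorbed by
replacing `l` with `l * t'`. -/
theorem comp_mem_quotients {a t t' : Smax Γ} (ht : IsSigned t) (ht' : IsTangible t')
    (h : t * t' = 1) {P Q : (Smax Γ)[X]} (hQ : Q ∈ quotients a P) :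
    Q.comp (C t * X) ∈ quotients (a * t') (P.comp (C t * X)) := by
  obtain ⟨hQs, l, hl, hb⟩ := hQ
  refine ⟨signedPoly_comp hQs ht, l * t', ⟨hl.1.mul ht'.1, mul_ne_zero' hl.2 ht'.2⟩, ?_⟩
  rintro (_ | k)
  · have := (hb 0).mul t'
    rw [coeff_zero_X_add_C_mul, coeff_C_mul, Smax.mul_neg] at this
    rw [coeff_zero_X_add_C_mul, coeff_C_mul, comp_C_mul_X_coeff, comp_C_mul_X_coeff, pow_zero,
      mul_one, mul_one]
    convert this using 1
    · ring
    · congr 1; ring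
  · have := (hb (k + 1)).mul (t ^ k)
    rw [coeff_succ_X_add_C_mul, coeff_C_mul, mul_add, Smax.mul_neg] at this
    rw [coeff_succ_X_add_C_mul, coeff_C_mul, comp_C_mul_X_coeff, comp_C_mul_X_coeff,
      comp_C_mul_X_coeff]
    convert this using 1
    · calc l * t' * (P.coeff (k + 1) * t ^ (k + 1))
          = t ^ k * (l * P.coeff (k + 1)) * (t * t') := by ring
        _ = _ := by rw [h, mul_one]
    · congr 1
      · ring
      · congr 1
        calc a * t' * (Q.coeff (k + 1) * t ^ (k + 1))
            = t ^ k * (a * Q.coeff (k + 1)) * (t * t') := by ring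
          _ = _ := by rw [h, mul_one]

theorem mult_eq_encard_changes {r : Smax Γ} (hr : IsSigned r) (hr0 : r ≠ 0) {P : (Smax Γ)[X]}
    (hP : SignedPoly P) (hP0 : P ≠ 0) :
    mult r P = (changes (signs (P.comp (C r * X)))).encard := by
  classical
  obtain ⟨s, hs, hs0, hrs⟩ := hr.exists_inv hr0
  -- Strong induction is needed because a general quotient may lose several changes; the supremum is
  -- attained by one that loses exactly one.
  have key : ∀ n : ℕ, ∀ P : (Smax Γ)[X], SignedPoly P → P ≠ 0 →
      (changes (signs (P.comp (C r * X)))).encard = n → mult r P = n := by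
    intro n
    induction n using Nat.strong_induction_on with
    | _ n ih =>
      intro P hP hP0 hn
      have hP' := signedPoly_comp hP hr
      have hP0' := comp_ne_zero hP0 hr0
      have hroot : IsRootOf r P ↔ (changes (signs (P.comp (C r * X)))).Nonempty := by
        rw [← isRootOf_one_iff hP' hP0', IsRootOf, IsRootOf, eval_comp]
        simp
      rw [mult_eq]
      rcases Nat.eq_zero_or_pos n with rfl | hpos
      · rw [if_neg]
        · rfl
        · rw [hroot, Set.not_nonempty_iff_eq_empty, ← Set.encard_eq_zero, hn]
          rfl
      · obtain ⟨n, rfl⟩ := Nat.exists_eq_add_of_le hpos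
        have hne : (changes (signs (P.comp (C r * X)))).Nonempty := by
          rw [← Set.encard_ne_zero, hn]
          exact_mod_cast hpos.ne'
        rw [if_pos (hroot.2 hne)]
        have hval : ∀ Q ∈ quotients r P,
            (changes (signs (Q.comp (C r * X)))).encard ≤ n ∧
              mult r Q = (changes (signs (Q.comp (C r * X)))).encard := by
          intro Q hQ
          have hQ0 := ne_zero_of_mem_quotients hP hP0 hQ
          have hQ' := comp_mem_quotients hr ⟨hs, hs0⟩ hrs hQ
          rw [hrs] at hQ'
          obtain ⟨hQs, l, hl, hb⟩ := hQ'
          have hle := encard_changes_signs_succ_le (signedPoly_C_mul hP' hl.1)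
            (C_mul_ne_zero hP0' hl.2) hQs (comp_ne_zero hQ0 hr0) hb
          rw [changes_signs_C_mul hl hP' hP0', hn] at hle
          have hfin : (changes (signs (Q.comp (C r * X)))).encard ≠ ⊤ :=
            encard_changes_ne_top (d := (Q.comp (C r * X)).natDegree + 1)
              fun j hj => signs_eq_zero (comp_ne_zero hQ0 hr0) hj
          obtain ⟨m, hm⟩ := ENat.ne_top_iff_exists.1 hfin
          rw [← hm] at hle ⊢
          have hmn : m + 1 ≤ 1 + n := by exact_mod_cast hle
          exact ⟨by exact_mod_cast (by omega : m ≤ n), ih m (by omega) Q hQ.1 hQ0 hm.symm⟩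
        rw [Nat.cast_add, Nat.cast_one]
        congr 1
        apply le_antisymm
        · exact iSup₂_le fun Q hQ => (hval Q hQ).2 ▸ (hval Q hQ).1
        -- The optimal quotient is built at the root `1` and carried back to `r` by the inverse
        -- substitution.
        · obtain ⟨R, hR, hRb, hRc⟩ := exists_polyBalances hP' hP0' hne
          have hsr : s * r = 1 := by rw [mul_comm, hrs]
          have hmem : R ∈ quotients 1 (P.comp (C r * X)) :=
            ⟨hR, 1, ⟨isSigned_one, one_ne_zero'⟩, by rwa [C_1, one_mul]⟩
          have hmem' := comp_mem_quotients hs ⟨hr, hr0⟩ hsr hmem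
          rw [one_mul, comp_comp_C_mul_X P hrs] at hmem'
          refine le_trans ?_ (le_iSup₂ (f := fun Q _ => mult r Q) _ hmem')
          rw [(hval _ hmem').2, comp_comp_C_mul_X R hsr]
          rw [hn, Nat.cast_add, Nat.cast_one, add_comm] at hRc
          exact (ENat.add_le_add_iff_right ENat.one_ne_top).1 hRc
  have hfin : (changes (signs (P.comp (C r * X)))).encard ≠ ⊤ :=
    encard_changes_ne_top (d := (P.comp (C r * X)).natDegree + 1)
      fun j hj => signs_eq_zero (comp_ne_zero hP0 hr0) hj
  obtain ⟨n, hn⟩ := ENat.ne_top_iff_exists.1 hfin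
  rw [← hn]
  exact key n P hP hP0 hn.symm

/-! ### The root zero -/

theorem mult_zero_eq {P : (Smax Γ)[X]} (hP : SignedPoly P) {n : ℕ}
    (h0 : ∀ i < n, P.coeff i = 0) (hn : P.coeff n ≠ 0) : mult 0 P = n := by
  classical
  induction n generalizing P with
  | zero =>
    rw [mult_eq, if_neg]
    · rfl
    · intro h
      apply hn
      rw [IsRootOf, ← coeff_zero_eq_eval_zero, ← mk_plus_minus (P.coeff 0), surpass_zero_mk] at h
      have := (isSigned_iff _).1 (hP 0)
      apply ext_plus_minus
      · rw [plus_zero]; grind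
      · rw [minus_zero]; grind
  | succ n ih =>
    have hroot : IsRootOf 0 P := by
      rw [IsRootOf, ← coeff_zero_eq_eval_zero, h0 0 (Nat.succ_pos n)]
      exact (surpass_zero_mk 0 0).2 rfl
    have hcoeff : ∀ (Q : (Smax Γ)[X]) k, ((X + C (-0)) * Q).coeff (k + 1) = Q.coeff k := by
      intro Q k
      rw [coeff_succ_X_add_C_mul, zero_mul, Smax.neg_zero, add_zero]
    have hval : ∀ Q ∈ quotients 0 P, mult 0 Q = n := by
      rintro Q ⟨hQ, l, hl, hb⟩
      -- For `a = 0` both sides of the balance relation have signed coefficients, so it is an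
      -- equality and leaves only `l · P / Y`.
      have hQc : ∀ k, Q.coeff k = l * P.coeff (k + 1) := by
        intro k
        have := hb (k + 1)
        rw [hcoeff, coeff_C_mul] at this
        exact (this.eq (hl.1.mul (hP _)) (hQ k)).symm
      refine ih hQ (fun i hi => ?_) ?_
      · rw [hQc, h0 _ (by omega), mul_zero]
      · rw [hQc]
        exact mul_ne_zero' hl.2 hn
    have hmem : P.divX ∈ quotients 0 P := by
      refine ⟨fun i => ?_, 1, ⟨isSigned_one, one_ne_zero'⟩, ?_⟩
      · rw [coeff_divX]
        exact hP _
      · rw [C_1, one_mul]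
        rintro (_ | k)
        · rw [h0 0 (Nat.succ_pos n), coeff_zero_X_add_C_mul, zero_mul]
          exact balances_refl
        · rw [hcoeff, coeff_divX]
          exact balances_refl
    rw [mult_eq, if_pos hroot, Nat.cast_add, Nat.cast_one, add_comm]
    congr 1
    apply le_antisymm
    · exact iSup₂_le fun Q hQ => (hval Q hQ).le
    · refine le_trans ?_ (le_iSup₂ (f := fun Q _ => mult 0 Q) _ hmem)
      exact (hval _ hmem).ge

theorem mult_zero_eq_natTrailingDegree {P : (Smax Γ)[X]} (hP : SignedPoly P) (hP0 : P ≠ 0) :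
    mult 0 P = (P.natTrailingDegree : ℕ∞) := by
  refine mult_zero_eq hP (fun i hi => coeff_eq_zero_of_lt_natTrailingDegree hi) ?_
  exact mt trailingCoeff_eq_zero.1 hP0

/-! ### Normalized and saturation polynomials -/

theorem mult_one_eq_encard_changes {P : (Smax Γ)[X]} (hP : SignedPoly P) (hP0 : P ≠ 0) :
    mult 1 P = (changes (signs P)).encard := by
  rw [mult_eq_encard_changes isSigned_one one_ne_zero' hP hP0, C_1, one_mul, comp_X]

theorem absHom_eval (P : (Smax Γ)[X]) (r : Smax Γ) :
    absHom (P.eval r) = (P.map absHom).eval (absHom r) :=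
  (eval_map_apply absHom r).symm

theorem absHom_eval_eq (P : (Smax Γ)[X]) (r : Smax Γ) :
    absHom (P.eval r) = absHom ((P.comp (C r * X)).eval 1) := by
  rw [eval_comp]
  simp

theorem absHom_eval_ne_zero {P : (Smax Γ)[X]} (hP0 : P ≠ 0) {r : Smax Γ} (hr0 : r ≠ 0) :
    absHom (P.eval r) ≠ 0 := by
  rw [absHom_eval_eq]
  exact absHom_eval_one_ne_zero (comp_ne_zero hP0 hr0)

theorem normalized_eq (P : (Smax Γ)[X]) (r : Smax Γ) :
    normalized P r = C (ofT (absHom (P.eval r))⁻¹) * P.comp (C r * X) := by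
  ext i
  rw [normalized, coeff_C_mul, comp_C_mul_X_coeff]
  simp only [finsetSum_coeff, coeff_monomial, Finset.sum_ite_eq', Finset.mem_range]
  split_ifs with h
  · ring
  · rw [coeff_eq_zero_of_natDegree_lt (by omega), zero_mul, mul_zero]

theorem signedPoly_normalized {P : (Smax Γ)[X]} (hP : SignedPoly P) {r : Smax Γ}
    (hr : IsSigned r) : SignedPoly (normalized P r) := by
  rw [normalized_eq]
  exact signedPoly_C_mul (signedPoly_comp hP hr) (isSigned_ofT _)

theorem absHom_eval_normalized {P : (Smax Γ)[X]} (hP0 : P ≠ 0) {r : Smax Γ} (hr0 : r ≠ 0) :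
    absHom ((normalized P r).eval 1) = 1 := by
  rw [normalized_eq, eval_mul, eval_C, map_mul, absHom_ofT, ← absHom_eval_eq,
    inv_mul_cancel₀ (absHom_eval_ne_zero hP0 hr0)]

theorem ne_zero_of_absHom_eval {P : (Smax Γ)[X]} {r : Smax Γ} (h : absHom (P.eval r) = 1) :
    P ≠ 0 := by
  rintro rfl
  rw [eval_zero, map_zero] at h
  exact zero_ne_one h

theorem signs_normalized {P : (Smax Γ)[X]} (hP0 : P ≠ 0) {r : Smax Γ} (hr0 : r ≠ 0) :
    signs (normalized P r) = signs (P.comp (C r * X)) := by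
  rw [normalized_eq, signs_ofT_mul (inv_ne_zero (absHom_eval_ne_zero hP0 hr0))]

theorem mem_sat_iff {P : (Smax Γ)[X]} {r : Smax Γ} (h : absHom (P.eval r) ≠ 0) {i : ℕ} :
    i ∈ sat r P ↔ absHom (P.eval r) = absHom (P.coeff i) * absHom r ^ i := by
  rw [sat, Finset.mem_filter, Finset.mem_range, and_iff_right_iff_imp]
  intro h'
  by_contra hi
  rw [coeff_eq_zero_of_natDegree_lt (by omega), map_zero, zero_mul] at h'
  exact h h'

theorem mem_sat_iff_normalized {P : (Smax Γ)[X]} (hP0 : P ≠ 0) {r : Smax Γ} (hr0 : r ≠ 0) {i : ℕ} :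
    i ∈ sat r P ↔ absHom ((normalized P r).coeff i) = 1 := by
  have h := absHom_eval_ne_zero hP0 hr0
  rw [mem_sat_iff h, normalized_eq, coeff_C_mul, comp_C_mul_X_coeff, map_mul, map_mul, map_pow,
    absHom_ofT, inv_mul_eq_one₀ h]

theorem sat_eq_sat_normalized {P : (Smax Γ)[X]} (hP0 : P ≠ 0) {r : Smax Γ} (hr0 : r ≠ 0) :
    sat r P = sat 1 (normalized P r) := by
  have h1 := absHom_eval_normalized hP0 hr0
  ext i
  rw [mem_sat_iff_normalized hP0 hr0, mem_sat_iff (by rw [h1]; exact one_ne_zero), h1, map_one,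
    one_pow, mul_one, eq_comm]

theorem satPoly_coeff (P : (Smax Γ)[X]) (r : Smax Γ) (i : ℕ) :
    (satPoly P r).coeff i = if i ∈ sat r P then (normalized P r).coeff i else 0 := by
  rw [satPoly]
  simp only [finsetSum_coeff, coeff_monomial, Finset.sum_ite_eq']

theorem signedPoly_satPoly {P : (Smax Γ)[X]} (hP : SignedPoly P) {r : Smax Γ}
    (hr : IsSigned r) : SignedPoly (satPoly P r) := by
  intro i
  rw [satPoly_coeff]
  split_ifs
  exacts [signedPoly_normalized hP hr i, isSigned_zero]

theorem absHom_eval_satPoly {P : (Smax Γ)[X]} (hP0 : P ≠ 0) {r : Smax Γ} (hr0 : r ≠ 0) :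
    absHom ((satPoly P r).eval 1) = 1 := by
  have h1 := absHom_eval_normalized hP0 hr0
  apply le_antisymm
  · refine absHom_eval_one_le fun i => ?_
    rw [satPoly_coeff]
    split_ifs
    · exact h1 ▸ absHom_coeff_le _ i
    · rw [map_zero]; exact Tmax.zero_le' _
  · obtain ⟨i, -, hi⟩ := exists_absHom_coeff (ne_zero_of_absHom_eval h1)
    rw [h1] at hi
    have := absHom_coeff_le (satPoly P r) i
    rwa [satPoly_coeff, if_pos ((mem_sat_iff_normalized hP0 hr0).2 hi), hi] at this

/-- Saturation deletes exactly the coefficients of absolute value different from the maximum `1`,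
whose sign is already recorded as `0`. -/
theorem signs_satPoly {P : (Smax Γ)[X]} (hP : SignedPoly P) (hP0 : P ≠ 0) {r : Smax Γ}
    (hr : IsSigned r) (hr0 : r ≠ 0) : signs (satPoly P r) = signs (normalized P r) := by
  funext i
  rw [signs, signs, absHom_eval_satPoly hP0 hr0, absHom_eval_normalized hP0 hr0, satPoly_coeff]
  split_ifs with h
  · rfl
  · rw [mem_sat_iff_normalized hP0 hr0] at h
    rw [level_zero one_ne_zero, eq_comm,
      level_eq_zero_iff one_ne_zero (signedPoly_normalized hP hr i)]
    exact h

theorem IsSigned.eq_one_or_neg_one {a : Smax Γ} (ha : IsSigned a) (h : absHom a = 1) :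
    a = 1 ∨ a = -1 := by
  obtain ⟨c, rfl | rfl⟩ := ha.exists_ofT
  · rw [absHom_ofT] at h
    exact Or.inl (by rw [h, map_one])
  · rw [absHom_neg, absHom_ofT] at h
    exact Or.inr (by rw [h, map_one])

theorem satPoly_coeff_mem {P : (Smax Γ)[X]} (hP : SignedPoly P) (hP0 : P ≠ 0) {r : Smax Γ}
    (hr : IsSigned r) (hr0 : r ≠ 0) (i : ℕ) :
    (satPoly P r).coeff i = 0 ∨ (satPoly P r).coeff i = 1 ∨ (satPoly P r).coeff i = -1 := by
  rw [satPoly_coeff]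
  split_ifs with h
  · exact Or.inr ((signedPoly_normalized hP hr i).eq_one_or_neg_one
      ((mem_sat_iff_normalized hP0 hr0).1 h))
  · exact Or.inl rfl

theorem signChanges_eq {P : (Smax Γ)[X]}
    (hP : ∀ i, P.coeff i = 0 ∨ P.coeff i = 1 ∨ P.coeff i = -1)
    (h1 : absHom (P.eval 1) = 1) : signChanges P = (changes (signs P)).encard := by
  have hs : SignedPoly P := by
    intro i
    rcases hP i with h | h | h <;> rw [h]
    exacts [isSigned_zero, isSigned_one, isSigned_one.neg]
  have h0 : ∀ i, signs P i = 0 ↔ P.coeff i = 0 := by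
    intro i
    rw [signs, h1, level_eq_zero_iff one_ne_zero (hs i)]
    rcases hP i with h | h | h <;> rw [h]
    · simp
    · simp [one_ne_zero']
    · rw [absHom_neg, map_one]
      simp only [ne_eq, not_true_eq_false, false_iff]
      intro hc
      have := congrArg absHom hc
      rw [absHom_neg, map_one, map_zero] at this
      exact one_ne_zero this
  have hneg : ∀ i j, P.coeff j ≠ 0 → (P.coeff i = -P.coeff j ↔ signs P i = -signs P j) := by
    intro i j hj
    have hj' := mt (h0 j).1 hj
    rw [signs, h1] at hj'
    rw [signs, signs, h1, ← level_neg one_ne_zero (hs j)]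
    constructor
    · intro h; rw [h]
    · intro h
      refine eq_of_level_eq one_ne_zero (hs i) (hs j).neg h ?_
      rwa [level_neg one_ne_zero (hs j), Ne, SignType.neg_eq_zero_iff]
  rw [signChanges]
  congr 1
  ext i
  constructor
  · rintro ⟨-, k, hk, e, hne, hz⟩
    exact ⟨k, hk, (hneg _ _ hne).1 e, mt (h0 _).1 hne, fun j hj hj' => (h0 j).2 (hz j hj hj')⟩
  · rintro ⟨k, hk, e, hne, hz⟩
    have hne' := mt (h0 _).2 hne
    -- The bound by the degree in `signChanges` is automatic, because the coefficient at `i + k` is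
    -- non-zero.
    exact ⟨lt_of_lt_of_le (by omega) (le_natDegree_of_ne_zero hne'), k, hk, (hneg _ _ hne').2 e,
      hne', fun j hj hj' => (h0 j).1 (hz j hj hj')⟩

/-! ### Comparison with the symmetrized Boolean semiring -/

theorem ofBool_le_iff {x y : Tmax PUnit.{1}} :
    Tmax.ofBool Γ x ≤ Tmax.ofBool Γ y ↔ x ≤ y := by
  rw [← max_eq_right_iff, ← max_eq_right_iff, ← Tmax.add_def, ← Tmax.add_def, ← map_add,
    Tmax.ofBool_injective.eq_iff]

theorem plus_ofBs (a : Bs) : plus (ofBs Γ a) = Tmax.ofBool Γ (plus a) := by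
  obtain ⟨x, y, rfl⟩ := mk_surjective a
  rw [ofBs_mk, plus_mk, plus_mk]
  simp only [ofBool_le_iff]
  split_ifs
  exacts [rfl, (map_zero _).symm]

theorem ofBs_neg (a : Bs) : ofBs Γ (-a) = -ofBs Γ a := by
  obtain ⟨x, y, rfl⟩ := mk_surjective a
  rfl

theorem minus_ofBs (a : Bs) : minus (ofBs Γ a) = Tmax.ofBool Γ (minus a) := by
  rw [minus, ← ofBs_neg, plus_ofBs]
  rfl

theorem absHom_ofBs (a : Bs) : absHom (ofBs Γ a) = Tmax.ofBool Γ (absHom a) := by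
  obtain ⟨x, y, rfl⟩ := mk_surjective a
  rw [ofBs_mk, absHom_mk, absHom_mk, map_add]

theorem signs_map_ofBs (q : Bs[X]) : signs (q.map (ofBs Γ)) = signs q := by
  funext i
  have : (q.map (ofBs Γ)).eval 1 = ofBs Γ (q.eval 1) := by
    rw [← eval_map_apply, map_one]
  simp only [signs, level, this, absHom_ofBs, coeff_map, plus_ofBs, minus_ofBs,
    Tmax.ofBool_injective.eq_iff]

/-- The sign change formula applies over the trivial group as well as over `Γ`, and the inclusion
preserves `signs`; the two sets of quotients need not be compared. -/
theorem mult_one_map_ofBs {q : Bs[X]} (hq : SignedPoly q)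
    (hs : SignedPoly (q.map (ofBs Γ))) (h0 : q.map (ofBs Γ) ≠ 0) :
    mult 1 q = mult 1 (q.map (ofBs Γ)) := by
  have hq0 : q ≠ 0 := by
    rintro rfl
    exact h0 (Polynomial.map_zero _)
  rw [mult_one_eq_encard_changes hq hq0, mult_one_eq_encard_changes hs h0, signs_map_ofBs]

theorem exists_map_ofBs {P : (Smax Γ)[X]}
    (hP : ∀ i, P.coeff i = 0 ∨ P.coeff i = 1 ∨ P.coeff i = -1) :
    ∃ q : Bs[X], SignedPoly q ∧ q.map (ofBs Γ) = P := by
  -- The last clause makes the chosen preimages vanish beyond the degree, so that they form a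
  -- polynomial.
  have : ∀ i, ∃ b : Bs, IsSigned b ∧ ofBs Γ b = P.coeff i ∧ (P.coeff i = 0 → b = 0) := by
    intro i
    by_cases h0 : P.coeff i = 0
    · exact ⟨0, isSigned_zero, by rw [map_zero, h0], fun _ => rfl⟩
    · rcases (hP i).resolve_left h0 with h | h
      · exact ⟨1, isSigned_one, by rw [map_one, h], fun h => absurd h h0⟩
      · exact ⟨-1, isSigned_one.neg, by rw [ofBs_neg, map_one, h], fun h => absurd h h0⟩
  choose f hf1 hf2 hf3 using this
  obtain ⟨q, hq⟩ := exists_coeff_eq (N := P.natDegree + 1) f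
    (fun k hk => hf3 k (coeff_eq_zero_of_natDegree_lt hk))
  refine ⟨q, fun i => hq i ▸ hf1 i, ?_⟩
  ext i
  rw [coeff_map, hq, hf2]

end Smax

/-! ### The main theorem -/

open Polynomial in
theorem mainTheorem3 {Γ : Type*} [AddCommGroup Γ] [LinearOrder Γ] [IsOrderedAddMonoid Γ]
    [Nontrivial Γ]
    (hdiv : ∀ n : ℕ, 0 < n → ∀ a : Γ, ∃ b : Γ, n • b = a)
    (P : (Smax Γ)[X]) (hP : Smax.SignedPoly P) (hP0 : P ≠ 0) :
    -- the root zero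
    Smax.mult 0 P = (P.natTrailingDegree : ℕ∞) ∧
    -- the non-zero roots
    ∀ r : Smax Γ, Smax.IsSigned r → r ≠ 0 →
      IsUnit r ∧
      -- the absolute value of the value at `r`
      (Smax.absHom (P.eval r) = (P.map Smax.absHom).eval (Smax.absHom r) ∧
        Smax.absHom (P.eval r) ≠ 0 ∧
        IsUnit (Smax.absHom (P.eval r)) ∧
        (∀ r' : Smax Γ, Smax.IsSigned r' → Smax.absHom r' = Smax.absHom r →
          Smax.absHom (P.eval r') = Smax.absHom (P.eval r)) ∧
        Smax.SignedPoly (Smax.normalized P r)) ∧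
      -- the saturation set
      ((∀ r' : Smax Γ, Smax.IsSigned r' → Smax.absHom r' = Smax.absHom r →
          Smax.sat r' P = Smax.sat r P) ∧
        Smax.sat r P = Smax.sat 1 (Smax.normalized P r)) ∧
      -- the saturation polynomial
      ((∀ i, (Smax.satPoly P r).coeff i = 0 ∨ (Smax.satPoly P r).coeff i = 1 ∨
          (Smax.satPoly P r).coeff i = -1) ∧
        (∃ q : Bs[X], Smax.SignedPoly q ∧ q.map (Smax.ofBs Γ) = Smax.satPoly P r) ∧
        (∀ q : Bs[X], Smax.SignedPoly q → q.map (Smax.ofBs Γ) = Smax.satPoly P r →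
          Smax.mult 1 q = Smax.mult 1 (Smax.satPoly P r))) ∧
      -- the multiplicity of `r`
      (Smax.mult r P = Smax.mult 1 (Smax.normalized P r) ∧
        Smax.mult r P = Smax.mult 1 (Smax.satPoly P r) ∧
        Smax.mult r P = Smax.signChanges (Smax.satPoly P r)) := by
  refine ⟨Smax.mult_zero_eq_natTrailingDegree hP hP0, fun r hr hr0 => ?_⟩
  have hM := Smax.absHom_eval_ne_zero hP0 hr0
  have habs : ∀ r' : Smax Γ, Smax.IsSigned r' → Smax.absHom r' = Smax.absHom r →
      Smax.absHom (P.eval r') = Smax.absHom (P.eval r) := fun r' _ h => by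
    rw [Smax.absHom_eval, Smax.absHom_eval, h]
  have hN := Smax.signedPoly_normalized hP hr
  have hN0 := Smax.ne_zero_of_absHom_eval (Smax.absHom_eval_normalized hP0 hr0)
  have hS := Smax.signedPoly_satPoly hP hr
  have hS1 := Smax.absHom_eval_satPoly hP0 hr0
  have hS0 := Smax.ne_zero_of_absHom_eval hS1
  have hcoeff := Smax.satPoly_coeff_mem hP hP0 hr hr0
  refine ⟨hr.isUnit hr0, ⟨Smax.absHom_eval P r, hM, hM.isUnit, habs, hN⟩,
    ⟨fun r' hr' h => ?_, Smax.sat_eq_sat_normalized hP0 hr0⟩,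
    ⟨hcoeff, Smax.exists_map_ofBs hcoeff, fun q hq h => ?_⟩, ?_, ?_, ?_⟩
  · simp only [Smax.sat, habs r' hr' h, h]
  · rw [← h] at hS hS0 ⊢
    exact Smax.mult_one_map_ofBs hq hS hS0
  · rw [Smax.mult_eq_encard_changes hr hr0 hP hP0, Smax.mult_one_eq_encard_changes hN hN0,
      Smax.signs_normalized hP0 hr0]
  · rw [Smax.mult_eq_encard_changes hr hr0 hP hP0, Smax.mult_one_eq_encard_changes hS hS0,
      Smax.signs_satPoly hP hP0 hr hr0, Smax.signs_normalized hP0 hr0]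
  · rw [Smax.mult_eq_encard_changes hr hr0 hP hP0, Smax.signChanges_eq hcoeff hS1,
      Smax.signs_satPoly hP hP0 hr hr0, Smax.signs_normalized hP0 hr0]
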